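/- Let $K$ be a field of characteristic $0$ and $V$ a vector space over $K$. Let $\mathcal L(V)$ be the free Lie algebra on $V$, with its natural action of $GL(V)$. For a partition $\lambda\vdash n$ let $P_\lambda$ be the irreducible $\mathfrak S_n$-module associated to $\lambda$ (the left ideal of $K[\mathfrak S_n]$ generated by the Young symmetrizer), and let $\mathbb S_\lambda(W)=W^{\otimes n}\otimes_{\mathfrak S_n}P_\lambda$ be the Schur functor. Let $c_{\lambda\mu}$ be the multiplicity of the $GL(V)$-module $\mathbb S_\lambda(V)$ in the $GL(V)$-module $\mathbb S_\mu(\mathcal L(V))$, that is, the largest $m$ such that $\mathbb S_\lambda(V)^{\oplus m}$ is a direct summand of $\mathbb S_\mu(\mathcal L(V))$. (Thus $\mathbb S_\mu(\mathcal L(V))\cong\bigoplus_\lambda \mathbb S_\lambda(V)^{\oplus c_{\lambda\mu}}$, the sum being over the partitions $\lambda$ with at most $\dim V$ parts.) Let $\lambda,\mu$ be partitions with $|\lambda|=|\mu|$, and suppose that $\dim V$ (possibly infinite) is at least the number of parts of $\lambda$, so that $\mathbb S_\lambda(V)\neq 0$. Then $$c_{\lambda\mu}=\begin{cases}1 & \text{if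 } \lambda=\mu,\\ 0 & \text{otherwise.}\end{cases}$$ -/

import Mathlib

/- Partitions are Mathlib's `YoungDiagram`s: rows are indexed by the first coordinate, `lam.card` is
the number of boxes, `lam.colLen 0` is the number of rows (i.e. of parts). For a partition with `n`
boxes the symmetric group on `n` letters is realised as the group `Equiv.Perm lam.cells` of
permutations of the boxes, so that no numbering of the boxes has to be chosen. -/

noncomputable section

open scoped TensorProduct

namespace LieSchur

/-! ### Irreducible modules of the symmetric group -/

section Specht

variable (K : Type*) [Field K] (lam : YoungDiagram)

open Classical in
/-- Permutations of the boxes that map every row to itself. -/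
def rowPerms : Finset (Equiv.Perm lam.cells) :=
  Finset.univ.filter fun p => ∀ c, (p c).1.1 = c.1.1

open Classical in
/-- Permutations of the boxes that map every column to itself. -/
def colPerms : Finset (Equiv.Perm lam.cells) :=
  Finset.univ.filter fun q => ∀ c, (q c).1.2 = c.1.2

/-- The Young symmetrizer: (sum over the row group) times (signed sum over the column group). -/
def youngSymmetrizer : MonoidAlgebra K (Equiv.Perm lam.cells) :=
  (∑ p ∈ rowPerms lam, MonoidAlgebra.single p 1) *
    ∑ q ∈ colPerms lam, MonoidAlgebra.single q (((Equiv.Perm.sign q : ℤ) : K))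

/-- The module `P_lam`: the left ideal of the group algebra generated by the Young symmetrizer. -/
def specht : Submodule K (MonoidAlgebra K (Equiv.Perm lam.cells)) :=
  LinearMap.range (LinearMap.mulRight K (youngSymmetrizer K lam))

/-- The symmetric group acts on `P_lam` by left multiplication. -/
def spechtRep : Representation K (Equiv.Perm lam.cells) (specht K lam) where
  toFun g := (LinearMap.mulLeft K (MonoidAlgebra.single g (1 : K))).restrict (by
    rintro _ ⟨x, rfl⟩
    exact ⟨MonoidAlgebra.single g 1 * x, by simp [mul_assoc]⟩)
  map_one' := by
    ext x : 2
    change MonoidAlgebra.single 1 1 * x.1 = x.1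
    rw [← MonoidAlgebra.one_def, one_mul]
  map_mul' g h := by
    ext x : 2
    change MonoidAlgebra.single (g * h) 1 * x.1 =
      MonoidAlgebra.single g 1 * (MonoidAlgebra.single h 1 * x.1)
    rw [← mul_assoc, MonoidAlgebra.single_mul_single, one_mul]

end Specht

/-! ### Schur functors -/

section Schur

variable (K : Type*) [Field K] (lam : YoungDiagram)

/-- The place permutation action on the tensor power of `W` indexed by the boxes of `lam`. -/
def placeRep (W : Type*) [AddCommGroup W] [Module K W] :
    Representation K (Equiv.Perm lam.cells) (⨂[K] _ : lam.cells, W) where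
  toFun g := (PiTensorProduct.reindex K (fun _ => W) g).toLinearMap
  map_one' := by
    ext v
    exact PiTensorProduct.reindex_tprod _ _
  map_mul' g h := by
    ext v
    change PiTensorProduct.reindex K _ (g * h) (PiTensorProduct.tprod K v) =
      PiTensorProduct.reindex K _ g (PiTensorProduct.reindex K _ h (PiTensorProduct.tprod K v))
    rw [PiTensorProduct.reindex_tprod, PiTensorProduct.reindex_tprod]
    exact (PiTensorProduct.reindex_tprod (R := K) (s := fun _ => W) g fun i => v (h.symm i)).symm

/-- The Schur functor `S_lam(W)`: the tensor product, over the group algebra of the symmetric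
group, of the tensor power of `W` with `P_lam`. It is realised as the coinvariants of the diagonal
action, that is, the quotient of the tensor product over `K` in which `(v · g) ⊗ p = v ⊗ (g · p)`,
where the right action on tensors is `v · g = g⁻¹ · v`. -/
def Schur (W : Type*) [AddCommGroup W] [Module K W] : Type _ :=
  ((placeRep K lam W).tprod (spechtRep K lam)).Coinvariants

instance (W : Type*) [AddCommGroup W] [Module K W] : AddCommGroup (Schur K lam W) :=
  inferInstanceAs (AddCommGroup (Representation.Coinvariants _))

instance (W : Type*) [AddCommGroup W] [Module K W] : Module K (Schur K lam W) :=
  inferInstanceAs (Module K (Representation.Coinvariants _))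

variable {W W' W'' : Type*} [AddCommGroup W] [Module K W] [AddCommGroup W'] [Module K W']
  [AddCommGroup W''] [Module K W'']

/-- The map `f ⊗ ⋯ ⊗ f ⊗ id` as an equivariant map. -/
def schurAux (f : W →ₗ[K] W') : Representation.IntertwiningMap
    ((placeRep K lam W).tprod (spechtRep K lam)) ((placeRep K lam W').tprod (spechtRep K lam)) where
  toLinearMap := TensorProduct.map (PiTensorProduct.map fun _ => f) LinearMap.id
  isIntertwining' g := by
    rw [Representation.tprod_apply, Representation.tprod_apply, ← TensorProduct.map_comp,
      ← TensorProduct.map_comp]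
    congr 1
    ext v
    simp [placeRep, PiTensorProduct.reindex_tprod]

/-- Functoriality: `S_lam(f)`. -/
def schurMap (f : W →ₗ[K] W') : Schur K lam W →ₗ[K] Schur K lam W' :=
  Representation.Coinvariants.map _ _ (schurAux K lam f)

theorem schurMap_id : schurMap K lam (LinearMap.id : W →ₗ[K] W) = LinearMap.id := by
  refine Representation.Coinvariants.hom_ext (LinearMap.ext fun x => ?_)
  change Representation.Coinvariants.mk _ (TensorProduct.map _ _ x) =
    Representation.Coinvariants.mk _ x
  rw [PiTensorProduct.map_id, TensorProduct.map_id, LinearMap.id_apply]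

theorem schurMap_comp (g : W' →ₗ[K] W'') (f : W →ₗ[K] W') :
    schurMap K lam (g ∘ₗ f) = schurMap K lam g ∘ₗ schurMap K lam f := by
  refine Representation.Coinvariants.hom_ext (LinearMap.ext fun x => ?_)
  change Representation.Coinvariants.mk _ (TensorProduct.map _ _ x) =
    Representation.Coinvariants.mk _ (TensorProduct.map _ _ (TensorProduct.map _ _ x))
  rw [← LinearMap.comp_apply (TensorProduct.map _ _), ← TensorProduct.map_comp,
    ← PiTensorProduct.map_comp, LinearMap.id_comp]

/-- A group acting linearly on `W` acts on `S_lam(W)`. -/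
def schurRep {G : Type*} [Monoid G] (rho : Representation K G W) :
    Representation K G (Schur K lam W) where
  toFun g := schurMap K lam (rho g)
  map_one' := by
    rw [map_one]
    exact schurMap_id K lam
  map_mul' g h := by
    rw [map_mul]
    exact schurMap_comp K lam _ _

end Schur

/-! ### The free Lie algebra on a vector space -/

section FreeLie

variable (K : Type*) [Field K] (V : Type*) [AddCommGroup V] [Module K V]

/-- The Lie ideal of the free Lie algebra on the set `V` that makes the inclusion of `V` linear. -/
def linearRelations : LieIdeal K (FreeLieAlgebra K V) :=
  LieSubmodule.lieSpan K (FreeLieAlgebra K V)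
    ({x | ∃ v w : V, x = FreeLieAlgebra.of K (v + w) - FreeLieAlgebra.of K v -
        FreeLieAlgebra.of K w} ∪
      {x | ∃ (a : K) (v : V), x = FreeLieAlgebra.of K (a • v) - a • FreeLieAlgebra.of K v})

/-- The free Lie algebra on the vector space `V`. -/
abbrev FreeLie : Type _ := FreeLieAlgebra K V ⧸ linearRelations K V

namespace FreeLie

variable {V}

/-- The quotient map from the free Lie algebra on the set `V`. -/
def mk : FreeLieAlgebra K V →ₗ⁅K⁆ FreeLie K V :=
  { (linearRelations K V).toSubmodule.mkQ with map_lie' := rfl }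

/-- The canonical linear map from `V` to the free Lie algebra on `V`. -/
def incl : V →ₗ[K] FreeLie K V where
  toFun v := LieSubmodule.Quotient.mk (FreeLieAlgebra.of K v)
  map_add' v w := by
    rw [← sub_eq_zero, ← sub_sub]
    exact (LieSubmodule.Quotient.mk_eq_zero' (N := linearRelations K V)).2
      (LieSubmodule.subset_lieSpan (Or.inl ⟨v, w, rfl⟩))
  map_smul' a v := by
    rw [← sub_eq_zero]
    exact (LieSubmodule.Quotient.mk_eq_zero' (N := linearRelations K V)).2
      (LieSubmodule.subset_lieSpan (Or.inr ⟨a, v, rfl⟩))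

variable {K} {L : Type*} [LieRing L] [LieAlgebra K L]

theorem linearRelations_le_ker (f : V →ₗ[K] L) :
    linearRelations K V ≤ (FreeLieAlgebra.lift K (f : V → L)).ker := by
  refine LieSubmodule.lieSpan_le.2 ?_
  rintro _ (⟨v, w, rfl⟩ | ⟨a, v, rfl⟩) <;> simp [LieHom.mem_ker]

/-- Universal property: a linear map from `V` to a Lie algebra extends to the free Lie algebra. -/
def lift (f : V →ₗ[K] L) : FreeLie K V →ₗ⁅K⁆ L :=
  { (linearRelations K V).toSubmodule.liftQ (FreeLieAlgebra.lift K (f : V → L)).toLinearMap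
      (fun _ hx => linearRelations_le_ker f hx) with
    map_lie' := by
      intro x y
      induction x using Submodule.Quotient.induction_on with | _ x => ?_
      induction y using Submodule.Quotient.induction_on with | _ y => ?_
      exact (FreeLieAlgebra.lift K (f : V → L)).map_lie x y }

theorem lift_incl (f : V →ₗ[K] L) (v : V) : lift f (incl K v) = f v :=
  FreeLieAlgebra.lift_of_apply (f : V → L) v

theorem hom_ext {F G : FreeLie K V →ₗ⁅K⁆ L} (h : ∀ v, F (incl K v) = G (incl K v)) : F = G := by
  have key : F.comp (mk K) = G.comp (mk K) := FreeLieAlgebra.hom_ext fun v => h v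
  ext x
  induction x using Submodule.Quotient.induction_on with | _ x => ?_
  exact LieHom.congr_fun key x

/-- Functoriality of the free Lie algebra. -/
def map (f : V →ₗ[K] V) : FreeLie K V →ₗ⁅K⁆ FreeLie K V := lift (incl K ∘ₗ f)

end FreeLie

/-- A group acting linearly on `V` acts on the free Lie algebra on `V` by automorphisms. -/
def freeLieRep {K V : Type*} [Field K] [AddCommGroup V] [Module K V] {G : Type*} [Monoid G]
    (rho : Representation K G V) : Representation K G (FreeLie K V) where
  toFun g := (FreeLie.map (rho g) : FreeLie K V →ₗ[K] FreeLie K V)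
  map_one' := by
    have : FreeLie.map (rho 1) = LieHom.id := FreeLie.hom_ext fun v => by
      simp [FreeLie.map, FreeLie.lift_incl]
    rw [this]; rfl
  map_mul' g h := by
    have : FreeLie.map (rho (g * h)) = (FreeLie.map (rho g)).comp (FreeLie.map (rho h)) :=
      FreeLie.hom_ext fun v => by simp [FreeLie.map, FreeLie.lift_incl]
    rw [this]; rfl

end FreeLie

/-! ### Multiplicities -/

/-- `sigma^{⊕ m}` is (isomorphic to) a direct summand of `rho`. -/
def IsSummand {K G S M : Type*} [Field K] [Monoid G] [AddCommGroup S] [Module K S]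
    [AddCommGroup M] [Module K M] (sigma : Representation K G S) (rho : Representation K G M)
    (m : ℕ) : Prop :=
  ∃ (i : Representation.IntertwiningMap
        (Representation.directSum fun _ : Fin m => sigma) rho)
    (r : Representation.IntertwiningMap rho
        (Representation.directSum fun _ : Fin m => sigma)),
    ∀ x, r (i x) = x

/-- The number of times `sigma` appears in the decomposition of `rho`: the supremum, in `ℕ∞`, of
the `m` such that `sigma^{⊕ m}` is a direct summand of `rho`. -/
def multiplicity {K G S M : Type*} [Field K] [Monoid G] [AddCommGroup S] [Module K S]
    [AddCommGroup M] [Module K M] (sigma : Representation K G S) (rho : Representation K G M) :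
    ℕ∞ :=
  ⨆ (m : ℕ) (_ : IsSummand sigma rho m), (m : ℕ∞)

/-- The tautological representation of `GL(V)` on `V`. -/
def stdRep (K V : Type*) [Field K] [AddCommGroup V] [Module K V] :
    Representation K (LinearMap.GeneralLinearGroup K V) V :=
  Units.coeHom (V →ₗ[K] V)

/-- The coefficient `c_{lam mu}`: the number of times the `GL(V)`-module `S_lam(V)` appears in the
decomposition of the `GL(V)`-module `S_mu(L(V))`, where `L(V)` is the free Lie algebra on `V`. -/
def coeff (K V : Type*) [Field K] [AddCommGroup V] [Module K V] (lam mu : YoungDiagram) : ℕ∞ :=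
  multiplicity (schurRep K lam (stdRep K V)) (schurRep K mu (freeLieRep (stdRep K V)))

end LieSchur

end

/-! The free Lie algebra is `V` plus brackets of degree at least two. The scalar 2 in `GL(V)` acts
on `S_lam(V)` by `2 ^ |lam|`, and on `L(V)` by the endomorphism `double`, which has eigenvalue `2 ^
k` in degree `k`. In `S_mu(L(V))` a tensor of `|mu|` homogeneous factors, not all of degree one, has
eigenvalue `2 ^ k` with `k > |mu|`. Hence the `2 ^ |mu|`-eigenspace is the image of `S_mu(V)`
(`schurMap_degOne_eq`), and for `|lam| = |mu|` every equivariant map `S_lam(V) → S_mu(L(V))` lands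
there. It remains to see that equivariant maps `S_lam(V) → S_mu(V)` vanish for `lam ≠ mu` and are
scalars for `lam = mu`.

The Young symmetrizer is a nonzero multiple of an idempotent, so Schur functors are direct summands
of tensor powers, and such a map extends to an equivariant map `F` of tensor powers. A full double
centralizer theorem is avoided: only the values of `F` on row-symmetric tensors matter. Let `t` be
the tensor with one basis vector per row, which exists because `dim V` is at least the number of
rows. Weights force `F t` to be a combination of place permutations of `t`. By Zariski density of
the `GL(V)`-orbit and polarization, the same combination computes `F` on all row-symmetric tensors
(`exists_comp_rowSum_eq`).

Surrounded by Young symmetrizers, a place permutation gives zero if `lam ≠ mu` and a multiple of the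
symmetrizer if `lam = mu`. This is von Neumann's argument: two boxes in one row sent to one column
give a transposition that makes the product equal to its negative. -/

noncomputable section

open scoped TensorProduct

namespace LieSchur

/-! ### Row and column positions under a bijection of two diagrams -/

section Combinatorics

variable {lam mu : YoungDiagram}

/-- The pair formed by the row of a box and the column of its image. -/
def rowCol (h : lam.cells ≃ mu.cells) (x : lam.cells) : ℕ × ℕ := (x.1.1, (h x).1.2)

/-- The weight `column - rowLen(row)` is negative on the boxes of `lam` and nonnegative off them. So
among sets of positions of the same size the diagram has the least total weight, attained by no
other set that misses one of its boxes. The row-length terms cancel, leaving the column sums. This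
plays the role of the dominance order. -/
theorem sum_col_le (h : lam.cells ≃ mu.cells) (hinj : Function.Injective (rowCol h)) :
    ∑ x : lam.cells, x.1.2 ≤ ∑ y : mu.cells, y.1.2 ∧
      (∑ x : lam.cells, x.1.2 = ∑ y : mu.cells, y.1.2 → ∀ x, rowCol h x ∈ lam.cells) := by
  classical
  let D := lam.cells
  set I := Finset.univ.image (rowCol h) with hI
  let w : ℕ × ℕ → ℤ := fun z => (z.2 : ℤ) - lam.rowLen z.1
  have hcardI : I.card = D.card := by
    rw [hI, Finset.card_image_of_injective _ hinj, Finset.card_univ, Fintype.card_coe]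
  have h1 : ∑ z ∈ I, w z = (∑ y : mu.cells, (y.1.2 : ℤ)) - ∑ x : D, (lam.rowLen x.1.1 : ℤ) := by
    rw [hI, Finset.sum_image fun a _ b _ hab => hinj hab,
      ← Equiv.sum_comp h fun y => (y.1.2 : ℤ), ← Finset.sum_sub_distrib]
    rfl
  have h2 : ∑ z ∈ D, w z = (∑ x : D, (x.1.2 : ℤ)) - ∑ x : D, (lam.rowLen x.1.1 : ℤ) := by
    rw [← Finset.sum_coe_sort D, ← Finset.sum_sub_distrib]
  have h3 := Finset.sum_inter_add_sum_sdiff D I w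
  have h4 := Finset.sum_inter_add_sum_sdiff I D w
  rw [Finset.inter_comm] at h4
  have neg : ∀ z ∈ D \ I, w z < 0 := fun z hz => by
    have := YoungDiagram.mem_iff_lt_rowLen.1 (show (z.1, z.2) ∈ lam from (Finset.mem_sdiff.1 hz).1)
    simp only [w]; omega
  have pos : 0 ≤ ∑ z ∈ I \ D, w z := Finset.sum_nonneg fun z hz => by
    have := mt YoungDiagram.mem_iff_lt_rowLen.2
      (show ¬ (z.1, z.2) ∈ lam from (Finset.mem_sdiff.1 hz).2)
    simp only [w]; omega
  have neg' : ∑ z ∈ D \ I, w z ≤ 0 := Finset.sum_nonpos fun z hz => (neg z hz).le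
  constructor
  · zify; linarith
  · intro heq
    zify at heq
    have hDI : D ⊆ I := by
      rw [← Finset.sdiff_eq_empty_iff_subset]
      by_contra hne
      have := Finset.sum_lt_sum_of_nonempty (Finset.nonempty_iff_ne_empty.2 hne) neg
      rw [Finset.sum_const_zero] at this
      linarith
    intro x
    change _ ∈ D
    rw [Finset.eq_of_subset_of_card_le hDI hcardI.le]
    exact Finset.mem_image_of_mem _ (Finset.mem_univ x)

/-- A bijection whose row and column positions are injective and fill the first diagram
preserves the lengths of the columns. -/
theorem eq_of_rowCol_mem (h : lam.cells ≃ mu.cells) (hinj : Function.Injective (rowCol h))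
    (hmem : ∀ x, rowCol h x ∈ lam.cells) : lam = mu := by
  classical
  let p : lam.cells ≃ lam.cells := Equiv.ofBijective (fun x => ⟨rowCol h x, hmem x⟩)
    (Finite.injective_iff_bijective.1 fun x y hxy => hinj (congrArg Subtype.val hxy))
  have hp : ∀ x, (p x).1.2 = (h x).1.2 := fun x => rfl
  have hcol : ∀ j, lam.colLen j = mu.colLen j := fun j => by
    rw [YoungDiagram.colLen_eq_card, YoungDiagram.colLen_eq_card]
    refine Finset.card_bij (fun c hc => (h (p.symm ⟨c, (Finset.mem_filter.1 hc).1⟩)).1) ?_ ?_ ?_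
    · intro c hc
      refine Finset.mem_filter.2 ⟨Subtype.prop _, ?_⟩
      rw [← hp, Equiv.apply_symm_apply]
      exact (Finset.mem_filter.1 hc).2
    · intro a ha b hb hab
      simpa using hab
    · intro b hb
      obtain ⟨hb1, hb2⟩ := Finset.mem_filter.1 hb
      refine ⟨(p (h.symm ⟨b, hb1⟩)).1, Finset.mem_filter.2 ⟨Subtype.prop _, ?_⟩, by simp⟩
      rw [hp, Equiv.apply_symm_apply]
      exact hb2
  ext ⟨i, j⟩
  rw [YoungDiagram.mem_cells, YoungDiagram.mem_cells, YoungDiagram.mem_iff_lt_colLen,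
    YoungDiagram.mem_iff_lt_colLen, hcol]

/-- Two distinct boxes of one row are sent to boxes of one column. -/
def HasCollision (h : lam.cells ≃ mu.cells) : Prop :=
  ∃ x y, x ≠ y ∧ x.1.1 = y.1.1 ∧ (h x).1.2 = (h y).1.2

theorem rowCol_injective {h : lam.cells ≃ mu.cells} (hh : ¬ HasCollision h) :
    Function.Injective (rowCol h) := fun x y hxy => by
  by_contra hne
  exact hh ⟨x, y, hne, (Prod.ext_iff.1 hxy).1, (Prod.ext_iff.1 hxy).2⟩

/-- Collision-free bijections in both directions would make the two column sums equal, and the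
equality case of `sum_col_le` then identifies the diagrams. -/
theorem forall_hasCollision_or (hne : lam ≠ mu) :
    (∀ h : lam.cells ≃ mu.cells, HasCollision h) ∨
      ∀ h : mu.cells ≃ lam.cells, HasCollision h := by
  by_contra! hcon
  obtain ⟨⟨h, hh⟩, g, hg⟩ := hcon
  have h1 := sum_col_le h (rowCol_injective hh)
  have h2 := sum_col_le g (rowCol_injective hg)
  exact hne (eq_of_rowCol_mem h (rowCol_injective hh) (h1.2 (h1.1.antisymm h2.1)))

theorem mem_rowPerms {p : Equiv.Perm lam.cells} : p ∈ rowPerms lam ↔ ∀ c, (p c).1.1 = c.1.1 := by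
  simp [rowPerms]

theorem mem_colPerms {p : Equiv.Perm lam.cells} : p ∈ colPerms lam ↔ ∀ c, (p c).1.2 = c.1.2 := by
  simp [colPerms]

theorem mul_mem_rowPerms {p q : Equiv.Perm lam.cells} (hp : p ∈ rowPerms lam)
    (hq : q ∈ rowPerms lam) : p * q ∈ rowPerms lam := by
  rw [mem_rowPerms] at *
  exact fun c => (hp _).trans (hq _)

theorem mul_mem_colPerms {p q : Equiv.Perm lam.cells} (hp : p ∈ colPerms lam)
    (hq : q ∈ colPerms lam) : p * q ∈ colPerms lam := by
  rw [mem_colPerms] at *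
  exact fun c => (hp _).trans (hq _)

theorem inv_mem_rowPerms {p : Equiv.Perm lam.cells} (hp : p ∈ rowPerms lam) :
    p⁻¹ ∈ rowPerms lam := by
  rw [mem_rowPerms] at *
  exact fun c => by rw [← hp]; simp

theorem inv_mem_colPerms {p : Equiv.Perm lam.cells} (hp : p ∈ colPerms lam) :
    p⁻¹ ∈ colPerms lam := by
  rw [mem_colPerms] at *
  exact fun c => by rw [← hp]; simp

theorem swap_mem_rowPerms [DecidableEq lam.cells] {x y : lam.cells} (h : x.1.1 = y.1.1) :
    Equiv.swap x y ∈ rowPerms lam := by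
  rw [mem_rowPerms]
  intro c
  rw [Equiv.swap_apply_def]
  split_ifs with h1 h2
  · rw [h1, h]
  · rw [h2, h]
  · rfl

theorem swap_mem_colPerms [DecidableEq lam.cells] {x y : lam.cells} (h : x.1.2 = y.1.2) :
    Equiv.swap x y ∈ colPerms lam := by
  rw [mem_colPerms]
  intro c
  rw [Equiv.swap_apply_def]
  split_ifs with h1 h2
  · rw [h1, h]
  · rw [h2, h]
  · rfl

theorem eq_one_of_mem_rowPerms_of_mem_colPerms {p : Equiv.Perm lam.cells}
    (h1 : p ∈ rowPerms lam) (h2 : p ∈ colPerms lam) : p = 1 := by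
  ext c : 2
  exact Prod.ext (mem_rowPerms.1 h1 c) (mem_colPerms.1 h2 c)

/-- Von Neumann's lemma. With a single diagram the column sums agree trivially, so without a
collision `x ↦ (row x, column (h x))` is itself a row permutation `p`, and `h * p⁻¹` preserves
columns. -/
theorem exists_eq_mul_or_hasCollision (h : Equiv.Perm lam.cells) :
    (∃ q ∈ colPerms lam, ∃ p ∈ rowPerms lam, h = q * p) ∨ HasCollision h := by
  by_cases hh : HasCollision h
  · exact Or.inr hh
  have hinj := rowCol_injective hh
  have hmem := (sum_col_le h hinj).2 rfl
  let p : Equiv.Perm lam.cells := Equiv.ofBijective (fun x => ⟨rowCol h x, hmem x⟩)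
    (Finite.injective_iff_bijective.1 fun x y hxy => hinj (congrArg Subtype.val hxy))
  refine Or.inl ⟨h * p⁻¹, mem_colPerms.2 fun c => ?_, p, mem_rowPerms.2 fun c => rfl, by simp⟩
  obtain ⟨c, rfl⟩ := p.surjective c
  rw [Equiv.Perm.mul_apply, Equiv.Perm.inv_def, Equiv.symm_apply_apply]
  rfl

end Combinatorics

/-! ### Row and column sums in an algebra -/

section Sums

variable {K : Type*} [Field K] {lam : YoungDiagram} {E : Type*} [Ring E] [Algebra K E]
  (rho : Equiv.Perm lam.cells →* E)

/-- The sum over the row group. -/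
def rowSum : E := ∑ p ∈ rowPerms lam, rho p

variable (K) in
/-- The signed sum over the column group. -/
def colSum : E := ∑ q ∈ colPerms lam, ((Equiv.Perm.sign q : ℤ) : K) • rho q

variable {rho}

theorem map_mul_rowSum {p : Equiv.Perm lam.cells} (hp : p ∈ rowPerms lam) :
    rho p * rowSum rho = rowSum rho := by
  rw [rowSum, Finset.mul_sum]
  refine Finset.sum_bij' (fun a _ => p * a) (fun a _ => p⁻¹ * a)
    (fun a ha => mul_mem_rowPerms hp ha) (fun a ha => mul_mem_rowPerms (inv_mem_rowPerms hp) ha)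
    (fun a _ => by simp) (fun a _ => by simp) fun a _ => by rw [map_mul]

theorem rowSum_mul_map {p : Equiv.Perm lam.cells} (hp : p ∈ rowPerms lam) :
    rowSum rho * rho p = rowSum rho := by
  rw [rowSum, Finset.sum_mul]
  refine Finset.sum_bij' (fun a _ => a * p) (fun a _ => a * p⁻¹)
    (fun a ha => mul_mem_rowPerms ha hp) (fun a ha => mul_mem_rowPerms ha (inv_mem_rowPerms hp))
    (fun a _ => by simp) (fun a _ => by simp) fun a _ => by rw [map_mul]

theorem sign_mul_sign_self (q : Equiv.Perm lam.cells) :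
    ((Equiv.Perm.sign q : ℤ) : K) * ((Equiv.Perm.sign q : ℤ) : K) = 1 := by
  rcases Int.units_eq_one_or (Equiv.Perm.sign q) with h | h <;> simp [h]

theorem map_mul_colSum {q : Equiv.Perm lam.cells} (hq : q ∈ colPerms lam) :
    rho q * colSum K rho = ((Equiv.Perm.sign q : ℤ) : K) • colSum K rho := by
  rw [colSum, Finset.mul_sum, Finset.smul_sum]
  refine Finset.sum_bij' (fun a _ => q * a) (fun a _ => q⁻¹ * a)
    (fun a ha => mul_mem_colPerms hq ha) (fun a ha => mul_mem_colPerms (inv_mem_colPerms hq) ha)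
    (fun a _ => by simp) (fun a _ => by simp) fun a _ => ?_
  rw [map_mul, map_mul, smul_smul, mul_smul_comm, Units.val_mul, Int.cast_mul, ← mul_assoc,
    sign_mul_sign_self, one_mul]

theorem colSum_mul_map {q : Equiv.Perm lam.cells} (hq : q ∈ colPerms lam) :
    colSum K rho * rho q = ((Equiv.Perm.sign q : ℤ) : K) • colSum K rho := by
  rw [colSum, Finset.sum_mul, Finset.smul_sum]
  refine Finset.sum_bij' (fun a _ => a * q) (fun a _ => a * q⁻¹)
    (fun a ha => mul_mem_colPerms ha hq) (fun a ha => mul_mem_colPerms ha (inv_mem_colPerms hq))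
    (fun a _ => by simp) (fun a _ => by simp) fun a _ => ?_
  rw [map_mul, map_mul, smul_smul, smul_mul_assoc, Units.val_mul, Int.cast_mul,
    mul_comm (((Equiv.Perm.sign a : ℤ)) : K), ← mul_assoc, sign_mul_sign_self, one_mul]

theorem rowSum_mul_rowSum : rowSum rho * rowSum rho = ((rowPerms lam).card : K) • rowSum rho := by
  conv_lhs => rw [rowSum, Finset.sum_mul]
  exact (Finset.sum_congr rfl fun p hp => map_mul_rowSum hp).trans
    (by rw [Finset.sum_const, Nat.cast_smul_eq_nsmul])

theorem card_rowPerms_ne_zero [CharZero K] : ((rowPerms lam).card : K) ≠ 0 :=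
  Nat.cast_ne_zero.2 (Finset.card_ne_zero.2 ⟨1, mem_rowPerms.2 fun _ => rfl⟩)

variable [CharZero K]

theorem eq_zero_of_eq_neg {M : Type*} [AddCommGroup M] [Module K M] {x : M} (h : x = -x) :
    x = 0 := by
  have : (2 : K) • x = 0 := by rw [two_smul]; nth_rewrite 2 [h]; exact add_neg_cancel x
  exact (smul_eq_zero.1 this).resolve_left two_ne_zero

variable (rho)

/-- A product `q * p` is absorbed by the two sums up to the sign of `q`. A collision gives a
transposition that the row sum absorbs and that, moved across `h`, changes the sign of the column
sum. -/
theorem colSum_mul_map_mul_rowSum (h : Equiv.Perm lam.cells) :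
    ∃ k : K, colSum K rho * rho h * rowSum rho = k • (colSum K rho * rowSum rho) := by
  classical
  rcases exists_eq_mul_or_hasCollision h with ⟨q, hq, p, hp, rfl⟩ | ⟨x, y, hxy, hrow, hcol⟩
  · refine ⟨((Equiv.Perm.sign q : ℤ) : K), ?_⟩
    rw [map_mul, ← mul_assoc, mul_assoc, map_mul_rowSum hp, colSum_mul_map hq, smul_mul_assoc]
  · refine ⟨0, ?_⟩
    rw [zero_smul]
    refine eq_zero_of_eq_neg (K := K) ?_
    have hs : h * Equiv.swap x y = Equiv.swap (h x) (h y) * h := Equiv.mul_swap_eq_swap_mul _ _ _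
    conv_lhs => rw [← map_mul_rowSum (rho := rho) (swap_mem_rowPerms hrow), mul_assoc,
      ← mul_assoc (rho h), ← map_mul, hs, map_mul, ← mul_assoc, ← mul_assoc,
      colSum_mul_map (swap_mem_colPerms hcol), Equiv.Perm.sign_swap (h.injective.ne hxy)]
    simp

theorem rowSum_mul_map_mul_colSum (h : Equiv.Perm lam.cells) :
    ∃ k : K, rowSum rho * rho h * colSum K rho = k • (rowSum rho * colSum K rho) := by
  classical
  rcases exists_eq_mul_or_hasCollision h⁻¹ with ⟨q, hq, p, hp, hqp⟩ | ⟨x, y, hxy, hrow, hcol⟩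
  · obtain rfl : h = p⁻¹ * q⁻¹ := by rw [← mul_inv_rev, ← hqp, inv_inv]
    refine ⟨((Equiv.Perm.sign q⁻¹ : ℤ) : K), ?_⟩
    rw [map_mul, ← mul_assoc, rowSum_mul_map (inv_mem_rowPerms hp), mul_assoc,
      map_mul_colSum (inv_mem_colPerms hq), mul_smul_comm]
  · refine ⟨0, ?_⟩
    rw [zero_smul]
    refine eq_zero_of_eq_neg (K := K) ?_
    have hs : Equiv.swap x y * h = h * Equiv.swap (h⁻¹ x) (h⁻¹ y) :=
      Equiv.swap_mul_eq_mul_swap _ _ _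
    conv_lhs => rw [← rowSum_mul_map (rho := rho) (swap_mem_rowPerms hrow), mul_assoc (rowSum rho),
      ← map_mul, hs, map_mul, mul_assoc, mul_assoc,
      map_mul_colSum (swap_mem_colPerms hcol), Equiv.Perm.sign_swap (h⁻¹.injective.ne hxy)]
    simp [mul_assoc]

end Sums

/-! ### The square of the Young symmetrizer -/

section Square

variable {K : Type*} [Field K] {lam : YoungDiagram} {E : Type*} [Ring E] [Algebra K E]
  (rho : Equiv.Perm lam.cells →* E)

theorem lift_rowSum :
    MonoidAlgebra.lift K _ _ rho (rowSum (MonoidAlgebra.of K (Equiv.Perm lam.cells))) =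
      rowSum rho := by
  simp [rowSum]

theorem lift_colSum :
    MonoidAlgebra.lift K _ _ rho (colSum K (MonoidAlgebra.of K (Equiv.Perm lam.cells))) =
      colSum K rho := by
  simp [colSum]

theorem youngSymmetrizer_eq : youngSymmetrizer K lam =
    rowSum (MonoidAlgebra.of K (Equiv.Perm lam.cells)) *
      colSum K (MonoidAlgebra.of K (Equiv.Perm lam.cells)) := by
  simp [youngSymmetrizer, rowSum, colSum]

section

variable [CharZero K]

theorem rowSum_mul_lift_mul_colSum (x : MonoidAlgebra K (Equiv.Perm lam.cells)) :
    ∃ k : K, rowSum rho * MonoidAlgebra.lift K _ _ rho x * colSum K rho =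
      k • (rowSum rho * colSum K rho) := by
  induction x using MonoidAlgebra.induction_on with
  | of g => simpa using rowSum_mul_map_mul_colSum (K := K) rho g
  | add x y hx hy =>
    obtain ⟨k, hk⟩ := hx
    obtain ⟨l, hl⟩ := hy
    exact ⟨k + l, by rw [map_add, mul_add, add_mul, hk, hl, add_smul]⟩
  | smul r x hx =>
    obtain ⟨k, hk⟩ := hx
    exact ⟨r * k, by rw [map_smul, mul_smul_comm, smul_mul_assoc, hk, smul_smul]⟩

theorem colSum_mul_lift_mul_rowSum (x : MonoidAlgebra K (Equiv.Perm lam.cells)) :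
    ∃ k : K, colSum K rho * MonoidAlgebra.lift K _ _ rho x * rowSum rho =
      k • (colSum K rho * rowSum rho) := by
  induction x using MonoidAlgebra.induction_on with
  | of g => simpa using colSum_mul_map_mul_rowSum (K := K) rho g
  | add x y hx hy =>
    obtain ⟨k, hk⟩ := hx
    obtain ⟨l, hl⟩ := hy
    exact ⟨k + l, by rw [map_add, mul_add, add_mul, hk, hl, add_smul]⟩
  | smul r x hx =>
    obtain ⟨k, hk⟩ := hx
    exact ⟨r * k, by rw [map_smul, mul_smul_comm, smul_mul_assoc, hk, smul_smul]⟩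

end

theorem trace_mulRight {G : Type*} [Group G] [Fintype G] (x : MonoidAlgebra K G) :
    LinearMap.trace K _ (LinearMap.mulRight K x) = Fintype.card G * x.coeff 1 := by
  classical
  rw [LinearMap.trace_eq_matrix_trace K (MonoidAlgebra.basis G K), Matrix.trace]
  simp [LinearMap.toMatrix_apply, MonoidAlgebra.basis]

theorem youngSymmetrizer_coeff_one : (youngSymmetrizer K lam).coeff 1 = 1 := by
  classical
  rw [youngSymmetrizer, Finset.sum_mul_sum]
  simp only [MonoidAlgebra.single_mul_single, one_mul, MonoidAlgebra.coeff_sum,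
    Finsupp.finsetSum_apply, MonoidAlgebra.coeff_single]
  rw [Finset.sum_eq_single 1, Finset.sum_eq_single 1]
  · simp
  · intro q _ hq
    rw [one_mul, Finsupp.single_eq_of_ne (Ne.symm hq)]
  · exact fun h => (h (mem_colPerms.2 fun _ => rfl)).elim
  · intro p hp hp1
    refine Finset.sum_eq_zero fun q hq => Finsupp.single_eq_of_ne fun h => hp1 ?_
    refine eq_one_of_mem_rowPerms_of_mem_colPerms hp ?_
    rw [eq_inv_of_mul_eq_one_left h.symm]
    exact inv_mem_colPerms hq
  · exact fun h => (h (mem_rowPerms.2 fun _ => rfl)).elim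

-- If the scalar were zero, right multiplication by the symmetrizer would be nilpotent, hence of
-- trace zero. Its trace is the group order times the coefficient at the identity, which is 1.
variable (K lam) in
theorem exists_youngSymmetrizer_mul_self [CharZero K] : ∃ k : K, k ≠ 0 ∧
    youngSymmetrizer K lam * youngSymmetrizer K lam = k • youngSymmetrizer K lam := by
  classical
  set of := MonoidAlgebra.of K (Equiv.Perm lam.cells)
  obtain ⟨k, hk⟩ := rowSum_mul_lift_mul_colSum (K := K) of (colSum K of * rowSum of)
  rw [map_mul, lift_rowSum, lift_colSum, mul_assoc, mul_assoc, ← mul_assoc (rowSum of),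
    ← youngSymmetrizer_eq] at hk
  refine ⟨k, ?_, hk⟩
  rintro rfl
  rw [zero_smul] at hk
  have hnil : IsNilpotent (LinearMap.mulRight K (youngSymmetrizer K lam)) :=
    ⟨2, LinearMap.ext fun x => by simp [pow_two, mul_assoc, hk]⟩
  have := (LinearMap.isNilpotent_trace_of_isNilpotent hnil).eq_zero
  rw [trace_mulRight, youngSymmetrizer_coeff_one, mul_one] at this
  exact Fintype.card_ne_zero (Nat.cast_eq_zero.1 this)

end Square

/-! ### Schur functors as direct summands of tensor powers -/

section Splitting

variable {K : Type*} [Field K] {lam : YoungDiagram} {W : Type*} [AddCommGroup W] [Module K W]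

/-- A representation composed with inversion, as a homomorphism to the opposite algebra. -/
def opRep {G M : Type*} [Group G] [AddCommGroup M] [Module K M] (rho : Representation K G M) :
    G →* (Module.End K M)ᵐᵒᵖ where
  toFun g := MulOpposite.op (rho g⁻¹)
  map_one' := by simp
  map_mul' g h := by rw [mul_inv_rev, map_mul, MulOpposite.op_mul]

/-- The right action of the group algebra on the tensor power. -/
def rightAct (x : MonoidAlgebra K (Equiv.Perm lam.cells)) :
    Module.End K (⨂[K] _ : lam.cells, W) :=
  (MonoidAlgebra.lift K _ _ (opRep (placeRep K lam W)) x).unop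

theorem rightAct_of (g : Equiv.Perm lam.cells) :
    rightAct (W := W) (MonoidAlgebra.of K _ g) = placeRep K lam W g⁻¹ := by
  simp [rightAct, opRep]

theorem rightAct_mul (x y : MonoidAlgebra K (Equiv.Perm lam.cells)) :
    rightAct (W := W) (x * y) = rightAct y * rightAct x := by
  rw [rightAct, map_mul, MulOpposite.unop_mul]; rfl

theorem rightAct_add (x y : MonoidAlgebra K (Equiv.Perm lam.cells)) :
    rightAct (W := W) (x + y) = rightAct x + rightAct y := by
  rw [rightAct, map_add]; rfl

theorem rightAct_smul (r : K) (x : MonoidAlgebra K (Equiv.Perm lam.cells)) :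
    rightAct (W := W) (r • x) = r • rightAct x := by
  rw [rightAct, map_smul]; rfl

theorem rightAct_rowSum : rightAct (W := W) (rowSum (MonoidAlgebra.of K (Equiv.Perm lam.cells))) =
    rowSum (placeRep K lam W) := by
  rw [rightAct, lift_rowSum, rowSum, rowSum, Finset.unop_sum]
  exact Finset.sum_bij' (fun a _ => a⁻¹) (fun a _ => a⁻¹) (fun a ha => inv_mem_rowPerms ha)
    (fun a ha => inv_mem_rowPerms ha) (fun a _ => inv_inv a) (fun a _ => inv_inv a) fun a _ => rfl

theorem rightAct_colSum :
    rightAct (W := W) (colSum K (MonoidAlgebra.of K (Equiv.Perm lam.cells))) =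
      colSum K (placeRep K lam W) := by
  rw [rightAct, lift_colSum, colSum, colSum, Finset.unop_sum]
  exact Finset.sum_bij' (fun a _ => a⁻¹) (fun a _ => a⁻¹) (fun a ha => inv_mem_colPerms ha)
    (fun a ha => inv_mem_colPerms ha) (fun a _ => inv_inv a) (fun a _ => inv_inv a)
    fun a _ => by rw [Equiv.Perm.sign_inv]; rfl

/-- A right action reverses products: rows are symmetrized first and columns antisymmetrized
afterwards. -/
theorem rightAct_youngSymmetrizer : rightAct (W := W) (youngSymmetrizer K lam) =
    colSum K (placeRep K lam W) * rowSum (placeRep K lam W) := by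
  rw [youngSymmetrizer_eq, rightAct_mul, rightAct_rowSum, rightAct_colSum]

theorem youngSymmetrizer_mem : youngSymmetrizer K lam ∈ specht K lam := ⟨1, by simp⟩

theorem mul_mem_specht (x : MonoidAlgebra K (Equiv.Perm lam.cells))
    {p : MonoidAlgebra K (Equiv.Perm lam.cells)} (hp : p ∈ specht K lam) :
    x * p ∈ specht K lam := by
  obtain ⟨y, rfl⟩ := hp
  exact ⟨x * y, by simp [mul_assoc]⟩

variable (K lam W) in
/-- The quotient map onto the Schur functor. -/
def schurMk : (⨂[K] _ : lam.cells, W) ⊗[K] specht K lam →ₗ[K] Schur K lam W :=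
  Representation.Coinvariants.mk ((placeRep K lam W).tprod (spechtRep K lam))

/-- The coinvariant relation for group elements extends linearly to the balancing relation of a
tensor product over the group algebra. -/
theorem schurMk_rightAct_tmul (x : MonoidAlgebra K (Equiv.Perm lam.cells))
    (v : ⨂[K] _ : lam.cells, W) (p : specht K lam) :
    schurMk K lam W (rightAct x v ⊗ₜ p) =
      schurMk K lam W (v ⊗ₜ ⟨x * p.1, mul_mem_specht x p.2⟩) := by
  induction x using MonoidAlgebra.induction_on with
  | of g =>
    rw [rightAct_of]
    exact Representation.Coinvariants.mk_inv_tmul (placeRep K lam W) (spechtRep K lam) v p g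
  | add x y hx hy =>
    rw [rightAct_add, LinearMap.add_apply, TensorProduct.add_tmul, map_add, hx, hy, ← map_add,
      ← TensorProduct.tmul_add]
    congr 3
    exact Subtype.ext (add_mul x y p.1).symm
  | smul r x hx =>
    rw [rightAct_smul, LinearMap.smul_apply, ← TensorProduct.smul_tmul', map_smul, hx, ← map_smul,
      ← TensorProduct.tmul_smul]
    congr 3
    exact Subtype.ext (smul_mul_assoc r x p.1).symm

variable (K lam W) in
/-- The projection from the tensor power to the Schur functor, `v ↦ v ⊗ c`. -/
def schurProj : (⨂[K] _ : lam.cells, W) →ₗ[K] Schur K lam W :=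
  schurMk K lam W ∘ₗ (TensorProduct.mk K _ _).flip ⟨youngSymmetrizer K lam, youngSymmetrizer_mem⟩

variable (K lam W) in
/-- The embedding of the Schur functor into the tensor power, `v ⊗ p ↦ v · p`. -/
def schurEmb : Schur K lam W →ₗ[K] ⨂[K] _ : lam.cells, W :=
  Representation.Coinvariants.lift _
    (TensorProduct.lift (LinearMap.flip
      { toFun := fun p : specht K lam => rightAct (W := W) p.1
        map_add' := fun p q => rightAct_add p.1 q.1
        map_smul' := fun r p => rightAct_smul r p.1 })) fun g => by
    refine TensorProduct.ext' fun v p => ?_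
    change rightAct (MonoidAlgebra.of K _ g * p.1) (placeRep K lam W g v) = rightAct p.1 v
    rw [rightAct_mul, rightAct_of, Module.End.mul_apply, ← Module.End.mul_apply (placeRep K lam W _),
      ← map_mul, inv_mul_cancel, map_one]
    rfl

theorem schurEmb_schurMk (v : ⨂[K] _ : lam.cells, W) (p : specht K lam) :
    schurEmb K lam W (schurMk K lam W (v ⊗ₜ p)) = rightAct p.1 v := rfl

theorem schurProj_apply (v : ⨂[K] _ : lam.cells, W) : schurProj K lam W v =
    schurMk K lam W (v ⊗ₜ ⟨youngSymmetrizer K lam, youngSymmetrizer_mem⟩) := rfl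

theorem schurEmb_schurProj (v : ⨂[K] _ : lam.cells, W) :
    schurEmb K lam W (schurProj K lam W v) =
      (colSum K (placeRep K lam W) * rowSum (placeRep K lam W)) v := by
  rw [schurProj_apply, schurEmb_schurMk, rightAct_youngSymmetrizer]

theorem schurProj_rowSum (v : ⨂[K] _ : lam.cells, W) :
    schurProj K lam W (rowSum (placeRep K lam W) v) =
      ((rowPerms lam).card : K) • schurProj K lam W v := by
  rw [schurProj_apply, ← rightAct_rowSum, schurMk_rightAct_tmul, schurProj_apply, ← map_smul,
    ← TensorProduct.tmul_smul]
  congr 3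
  change _ * youngSymmetrizer K lam = _ • youngSymmetrizer K lam
  rw [youngSymmetrizer_eq, ← mul_assoc, rowSum_mul_rowSum (K := K), smul_mul_assoc]

-- On `v ⊗ xc` the composite is `v ⊗ xc²`, with `c` the Young symmetrizer. So `schurEmb` and
-- `schurProj` split the Schur functor off the tensor power up to a nonzero scalar.
variable (K lam) in
theorem exists_schurProj_schurEmb [CharZero K] (W : Type*) [AddCommGroup W] [Module K W] :
    ∃ k : K, k ≠ 0 ∧ ∀ s, schurProj K lam W (schurEmb K lam W s) = k • s := by
  obtain ⟨k, hk, hc⟩ := exists_youngSymmetrizer_mul_self K lam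
  refine ⟨k, hk, fun s => ?_⟩
  suffices schurProj K lam W ∘ₗ schurEmb K lam W = k • LinearMap.id from LinearMap.congr_fun this s
  refine Representation.Coinvariants.hom_ext (TensorProduct.ext' fun v p => ?_)
  change schurProj K lam W (schurEmb K lam W (schurMk K lam W (v ⊗ₜ p))) =
    k • schurMk K lam W (v ⊗ₜ p)
  rw [schurEmb_schurMk, schurProj_apply, schurMk_rightAct_tmul, ← map_smul,
    ← TensorProduct.tmul_smul]
  congr 3
  obtain ⟨_, ⟨x, rfl⟩⟩ := p
  change x * youngSymmetrizer K lam * youngSymmetrizer K lam = k • (x * youngSymmetrizer K lam)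
  rw [mul_assoc, hc, mul_smul_comm]

theorem schurProj_surjective [CharZero K] : Function.Surjective (schurProj K lam W) := fun s => by
  obtain ⟨k, hk, h⟩ := exists_schurProj_schurEmb K lam W
  exact ⟨k⁻¹ • schurEmb K lam W s, by rw [map_smul, h, smul_smul, inv_mul_cancel₀ hk, one_smul]⟩

variable {W' : Type*} [AddCommGroup W'] [Module K W']

theorem schurMap_schurProj (f : W →ₗ[K] W') (v : ⨂[K] _ : lam.cells, W) :
    schurMap K lam f (schurProj K lam W v) =
      schurProj K lam W' (PiTensorProduct.map (fun _ => f) v) := rfl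

theorem map_reindex_apply {ι ι' : Type*} (f : W →ₗ[K] W') (g : ι ≃ ι') (v : ⨂[K] _ : ι, W) :
    PiTensorProduct.map (fun _ => f) (PiTensorProduct.reindex K (fun _ => W) g v) =
      PiTensorProduct.reindex K (fun _ => W') g (PiTensorProduct.map (fun _ => f) v) :=
  PiTensorProduct.map_reindex (fun _ => f) g v

theorem map_rowSum (f : W →ₗ[K] W') (v : ⨂[K] _ : lam.cells, W) :
    PiTensorProduct.map (fun _ => f) (rowSum (placeRep K lam W) v) =
      rowSum (placeRep K lam W') (PiTensorProduct.map (fun _ => f) v) := by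
  simp only [rowSum, LinearMap.sum_apply, map_sum]
  exact Finset.sum_congr rfl fun p _ => map_reindex_apply f p v

theorem map_colSum (f : W →ₗ[K] W') (v : ⨂[K] _ : lam.cells, W) :
    PiTensorProduct.map (fun _ => f) (colSum K (placeRep K lam W) v) =
      colSum K (placeRep K lam W') (PiTensorProduct.map (fun _ => f) v) := by
  simp only [colSum, LinearMap.sum_apply, map_sum, LinearMap.smul_apply, map_smul]
  exact Finset.sum_congr rfl fun p _ => congrArg _ (map_reindex_apply f p v)

theorem schurEmb_schurMap [CharZero K] (f : W →ₗ[K] W') (s : Schur K lam W) :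
    schurEmb K lam W' (schurMap K lam f s) =
      PiTensorProduct.map (fun _ => f) (schurEmb K lam W s) := by
  obtain ⟨v, rfl⟩ := schurProj_surjective s
  rw [schurMap_schurProj, schurEmb_schurProj, schurEmb_schurProj, Module.End.mul_apply,
    Module.End.mul_apply, map_colSum, map_rowSum]

end Splitting

/-! ### Equivariant maps between tensor powers -/

section TensorPower

variable {K : Type*} [Field K] {V : Type*} [AddCommGroup V] [Module K V]

/-- Commuting with the diagonal action of the general linear group on two functorial spaces. -/
def IsTensorEquivariant {α β : Type*} (F : (⨂[K] _ : α, V) →ₗ[K] ⨂[K] _ : β, V) : Prop :=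
  ∀ (g : LinearMap.GeneralLinearGroup K V) (v : ⨂[K] _ : α, V),
    F (PiTensorProduct.map (fun _ => (g : V →ₗ[K] V)) v) =
      PiTensorProduct.map (fun _ => (g : V →ₗ[K] V)) (F v)

/-! ### Weights of diagonal matrices on tensor powers -/

section Weights

variable {ι : Type*} (b : Module.Basis ι K V)

/-- The invertible diagonal map with given entries. -/
def diagUnit (c : ι → Kˣ) : LinearMap.GeneralLinearGroup K V where
  val := b.constr K fun j => (c j : K) • b j
  inv := b.constr K fun j => ((c j)⁻¹ : K) • b j
  val_inv := b.ext fun j => by simp [smul_smul]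
  inv_val := b.ext fun j => by simp [smul_smul]

theorem diagUnit_apply (c : ι → Kˣ) (j : ι) :
    (diagUnit b c : V →ₗ[K] V) (b j) = (c j : K) • b j := by
  simp [diagUnit]

theorem map_diagUnit_tprod {α : Type*} [Fintype α] (c : ι → Kˣ) (f : α → ι) :
    PiTensorProduct.map (fun _ => (diagUnit b c : V →ₗ[K] V))
        (PiTensorProduct.tprod K fun x => b (f x)) =
      (∏ x, (c (f x) : K)) • PiTensorProduct.tprod K fun x => b (f x) := by
  rw [PiTensorProduct.map_tprod]
  simp only [diagUnit_apply]
  exact MultilinearMap.map_smul_univ _ _ _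

theorem repr_map_diagUnit {α : Type*} [Fintype α] (c : ι → Kˣ) (t : ⨂[K] _ : α, V) (f : α → ι) :
    (Basis.piTensorProduct fun _ : α => b).repr
        (PiTensorProduct.map (fun _ => (diagUnit b c : V →ₗ[K] V)) t) f =
      (∏ x, (c (f x) : K)) * (Basis.piTensorProduct fun _ : α => b).repr t f := by
  classical
  let bas := Basis.piTensorProduct fun _ : α => b
  suffices (Finsupp.lapply f ∘ₗ bas.repr.toLinearMap) ∘ₗ
      PiTensorProduct.map (fun _ => (diagUnit b c : V →ₗ[K] V)) =
      (∏ x, (c (f x) : K)) • (Finsupp.lapply f ∘ₗ bas.repr.toLinearMap) from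
    LinearMap.congr_fun this t
  refine bas.ext fun f' => ?_
  rw [LinearMap.comp_apply, LinearMap.smul_apply]
  conv_lhs => rw [Basis.piTensorProduct_apply, map_diagUnit_tprod b c f', map_smul,
    ← Basis.piTensorProduct_apply]
  simp only [LinearMap.comp_apply, LinearEquiv.coe_coe, Finsupp.lapply_apply, smul_eq_mul,
    bas, Module.Basis.repr_self]
  by_cases h : f' = f
  · rw [h]
  · rw [Finsupp.single_eq_of_ne (Ne.symm h), mul_zero, mul_zero]

theorem prod_ite_two {α ι : Type*} [Fintype α] [DecidableEq ι] (f : α → ι) (i : ι) :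
    ∏ x, (if f x = i then (2 : K) else 1) = ((2 ^ Fintype.card {y // f y = i} : ℕ) : K) := by
  simp [Finset.prod_ite, Fintype.card_subtype]

/-- `F` preserves weights, so each basis tensor occurring in the image has the same basis vectors,
with multiplicity, as the source: it is a rearrangement of it. -/
theorem exists_sum_reindex [CharZero K] {α β : Type*} [Fintype α] [Fintype β] [DecidableEq α]
    [DecidableEq β] (F : (⨂[K] _ : α, V) →ₗ[K] ⨂[K] _ : β, V) (hF : IsTensorEquivariant F)
    (r : α → ι) :
    ∃ c : (α ≃ β) → K, F (PiTensorProduct.tprod K fun x => b (r x)) =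
      ∑ h, c h • PiTensorProduct.reindex K (fun _ => V) h
        (PiTensorProduct.tprod K fun x => b (r x)) := by
  classical
  set t := PiTensorProduct.tprod K fun x => b (r x)
  let bas := Basis.piTensorProduct fun _ : β => b
  suffices F t ∈ Submodule.span K
      (Set.range fun h : α ≃ β => PiTensorProduct.reindex K (fun _ => V) h t) by
    obtain ⟨c, hc⟩ := (Submodule.mem_span_range_iff_exists_fun K).1 this
    exact ⟨c, hc.symm⟩
  rw [← bas.linearCombination_repr (F t), Finsupp.linearCombination_apply]
  refine Submodule.sum_mem _ fun f hf => Submodule.smul_mem _ _ (Submodule.subset_span ?_)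
  have hf := Finsupp.mem_support_iff.1 hf
  have hcard : ∀ i, Fintype.card {x // r x = i} = Fintype.card {y // f y = i} := fun i => by
    -- The diagonal matrix with entry 2 at `i` and 1 elsewhere scales a basis tensor by 2 to the
    -- number of its factors `b i`; in characteristic 0 this number can be read off.
    let c : ι → Kˣ := fun j => if j = i then Units.mk0 2 two_ne_zero else 1
    have hc : ∀ j, (c j : K) = if j = i then 2 else 1 := fun j => by
      simp only [c]; split_ifs <;> simp
    have h1 := repr_map_diagUnit b c (F t) f
    rw [← hF, map_diagUnit_tprod, map_smul, map_smul, Finsupp.smul_apply, smul_eq_mul] at h1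
    have h2 := mul_right_cancel₀ hf h1
    simp only [hc, prod_ite_two, Nat.cast_inj] at h2
    exact Nat.pow_right_injective le_rfl h2
  let h : α ≃ β := Equiv.ofFiberEquiv (f := r) (g := f) fun i => Fintype.equivOfCardEq (hcard i)
  refine ⟨h, ?_⟩
  simp only [t, bas, Basis.piTensorProduct_apply]
  rw [PiTensorProduct.reindex_tprod]
  congr 1
  funext y
  rw [← Equiv.ofFiberEquiv_map (fun i => Fintype.equivOfCardEq (hcard i)) (h.symm y)]
  exact congrArg (fun z => b (f z)) (h.apply_symm_apply y)

end Weights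

/-! ### Zariski density of the invertible maps -/

section Density

/-- `μ + i ∘ p` is invertible when `μ` and `μ + p ∘ i` are. -/
theorem isUnit_smul_one_add_comp {W : Type*} [AddCommGroup W] [Module K W] (i : W →ₗ[K] V)
    (p : V →ₗ[K] W) {m : K} (hm : m ≠ 0) (h : IsUnit (m • (1 : Module.End K W) + p ∘ₗ i)) :
    IsUnit (m • (1 : Module.End K V) + i ∘ₗ p) := by
  obtain ⟨u, hu⟩ := h
  have h1 : ∀ w, m • (↑u⁻¹ : Module.End K W) w + p (i ((↑u⁻¹ : Module.End K W) w)) = w := fun w => by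
    have := LinearMap.congr_fun u.mul_inv w
    rw [hu] at this
    simpa using this
  have h2 : ∀ w, (↑u⁻¹ : Module.End K W) (m • w + p (i w)) = w := fun w => by
    have := LinearMap.congr_fun u.inv_mul w
    rw [hu] at this
    simpa using this
  -- The push-through (Woodbury) formula for the inverse, with `u = m + p ∘ i`.
  refine ⟨⟨_, m⁻¹ • (1 - i ∘ₗ (↑u⁻¹ : Module.End K W) ∘ₗ p), ?_, ?_⟩, rfl⟩
  · ext v
    have := congrArg i (h1 (p v))
    simp only [map_add, map_smul] at this
    simp only [Module.End.mul_apply, LinearMap.add_apply, LinearMap.smul_apply, Module.End.one_apply,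
      LinearMap.comp_apply, LinearMap.sub_apply, map_smul, map_sub]
    rw [this, add_sub_cancel_right, smul_smul, inv_mul_cancel₀ hm, one_smul]
  · ext v
    have := congrArg i (h2 (p v))
    simp only [Module.End.mul_apply, LinearMap.add_apply, LinearMap.smul_apply, Module.End.one_apply,
      LinearMap.comp_apply, LinearMap.sub_apply]
    rw [map_add, map_smul, this]
    simp [smul_smul, hm]

/-- Perturb the scalar `m` by the finite-rank map sending `b j` to `w j` for `j ∈ S` and the other
basis vectors to zero. It factors through `S → K`, so invertibility fails at most for `m = 0` and
for `m` in a finite spectrum, even when `V` is infinite-dimensional. -/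
theorem infinite_setOf_isUnit [CharZero K] {ι : Type*} (b : Module.Basis ι K V) (S : Finset ι)
    (w : ι → V) : {m : K | ∃ g : LinearMap.GeneralLinearGroup K V,
      ∀ j ∈ S, (g : V →ₗ[K] V) (b j) = m • b j + w j}.Infinite := by
  classical
  let i : (S → K) →ₗ[K] V := Fintype.linearCombination K fun j : S => w j
  let p : V →ₗ[K] (S → K) := LinearMap.pi fun j => b.coord j
  have hinf : (spectrum K (-(p ∘ₗ i)) ∪ {0})ᶜ.Infinite :=
    ((Module.End.finite_spectrum _).union (Set.finite_singleton 0)).infinite_compl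
  refine hinf.mono fun m hm => ?_
  rw [Set.mem_compl_iff, Set.mem_union, not_or, spectrum.notMem_iff, sub_neg_eq_add,
    Algebra.algebraMap_eq_smul_one] at hm
  obtain ⟨g, hg⟩ := isUnit_smul_one_add_comp i p hm.2 hm.1
  refine ⟨g, fun j hj => ?_⟩
  have hp : p (b j) = Pi.single ⟨j, hj⟩ 1 := by
    funext k
    simp [p, Pi.single_apply, Finsupp.single_apply, Subtype.ext_iff, eq_comm]
  rw [hg, LinearMap.add_apply, LinearMap.comp_apply, hp]
  simp [i, Fintype.linearCombination_apply_single]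

/-- Along the line `m • b + w` any functional of `F` is a polynomial in `m`. It vanishes at the
infinitely many `m` realized by invertible maps, hence also at `m = 0`. -/
theorem tprod_eq_zero_of_forall_map [CharZero K] {ι : Type*} (b : Module.Basis ι K V) {α : Type*}
    [Fintype α] (r : α → ι) {M : Type*} [AddCommGroup M] [Module K M] (F : (⨂[K] _ : α, V) →ₗ[K] M)
    (hF : ∀ g : LinearMap.GeneralLinearGroup K V,
      F (PiTensorProduct.map (fun _ => (g : V →ₗ[K] V))
        (PiTensorProduct.tprod K fun x => b (r x))) = 0) (w : ι → V) :
    F (PiTensorProduct.tprod K fun x => w (r x)) = 0 := by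
  classical
  refine (Module.forall_dual_apply_eq_zero_iff K _).1 fun ψ => ?_
  let P : Polynomial K := ∑ s : Finset α, Polynomial.C (ψ (F (PiTensorProduct.tprod K
    (s.piecewise (fun x => b (r x)) fun x => w (r x))))) * Polynomial.X ^ s.card
  have hP : ∀ m, P.eval m = ψ (F (PiTensorProduct.tprod K
      ((fun x => m • b (r x)) + fun x => w (r x)))) := fun m => by
    rw [MultilinearMap.map_add_univ, map_sum, map_sum, Polynomial.eval_finsetSum]
    refine Finset.sum_congr rfl fun s _ => ?_
    have : s.piecewise (fun x => m • b (r x)) (fun x => w (r x)) =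
        s.piecewise (fun x => m • (s.piecewise (fun x => b (r x)) fun x => w (r x)) x)
          (s.piecewise (fun x => b (r x)) fun x => w (r x)) := by
      funext x
      by_cases hx : x ∈ s <;> simp [hx]
    rw [this, MultilinearMap.map_piecewise_smul (PiTensorProduct.tprod K) (fun _ => m)]
    rw [Finset.prod_const, map_smul, map_smul, Polynomial.eval_mul, Polynomial.eval_C,
      Polynomial.eval_pow, Polynomial.eval_X, smul_eq_mul, mul_comm]
  have h0 : P = 0 := by
    refine Polynomial.eq_zero_of_infinite_isRoot _
      ((infinite_setOf_isUnit b (Finset.univ.image r) w).mono ?_)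
    rintro m ⟨g, hg⟩
    have := hF g
    rw [PiTensorProduct.map_tprod] at this
    rw [Set.mem_ofPred_eq, Polynomial.IsRoot.def, hP]
    convert map_zero ψ
    rw [← this]
    congr 2
    funext x
    exact (hg _ (Finset.mem_image_of_mem _ (Finset.mem_univ x))).symm
  have := hP 0
  rw [h0, Polynomial.eval_zero] at this
  rw [this]
  congr 3
  funext x
  simp

end Density

/-! ### Polarization of row-symmetric tensors -/

section Polarization

/-- Toggling an element outside `R` pairs off the supersets of `R` with opposite signs. -/
theorem sum_neg_one_pow_card_superset {α : Type*} [Fintype α] [DecidableEq α] (R : Finset α) :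
    ∑ S : Finset α, (if R ⊆ S then (-1 : K) ^ S.card else 0) =
      if R = Finset.univ then (-1 : K) ^ Fintype.card α else 0 := by
  split_ifs with hR
  · subst hR
    simp [Finset.univ_subset_iff, Finset.card_univ]
  · obtain ⟨a, ha⟩ : ∃ a, a ∉ R := by simpa [Finset.eq_univ_iff_forall] using hR
    refine Finset.sum_involution (fun S _ => if a ∈ S then S.erase a else insert a S) ?_ ?_ ?_ ?_
    · intro S _
      by_cases h : a ∈ S
      · have : R ⊆ S.erase a ↔ R ⊆ S := by rw [Finset.subset_erase]; exact and_iff_left ha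
        simp only [h, if_true, this]
        rw [← Finset.card_erase_add_one h]
        split_ifs <;> simp [pow_succ]
      · have : R ⊆ insert a S ↔ R ⊆ S := Finset.subset_insert_iff_of_notMem ha
        simp only [h, if_false, this, Finset.card_insert_of_notMem h]
        split_ifs <;> simp [pow_succ]
    · intro S _ _
      by_cases h : a ∈ S
      · simp only [h, if_true]
        exact fun h' => Finset.notMem_erase a S ((Finset.ext_iff.1 h' a).2 h)
      · simp only [h, if_false]
        exact fun h' => h (h' ▸ Finset.mem_insert_self a S)
    · exact fun _ _ => Finset.mem_univ _
    · intro S _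
      by_cases h : a ∈ S
      · simp only [h, if_true, Finset.notMem_erase, if_false]
        exact Finset.insert_erase h
      · simp only [h, if_true, Finset.mem_insert_self, if_false, Finset.erase_insert,
          not_false_eq_true]

variable {lam : YoungDiagram} {M : Type*} [AddCommGroup M] [Module K M]

/-- Polarization without dividing by factorials. Substituting partial row sums of `v` over a set `S`
of boxes gives a sum over row-preserving self-maps with values in `S`; the alternating sum over `S`
keeps the surjective ones, which are the row permutations. -/
theorem comp_rowSum_eq_zero {ι : Type*} (r : lam.cells → ι)
    (hr : ∀ x y, r x = r y ↔ x.1.1 = y.1.1) (F : (⨂[K] _ : lam.cells, V) →ₗ[K] M)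
    (hF : ∀ w : ι → V, F (PiTensorProduct.tprod K fun x => w (r x)) = 0) :
    F ∘ₗ rowSum (placeRep K lam V) = 0 := by
  classical
  refine PiTensorProduct.ext (MultilinearMap.ext fun v => ?_)
  change F (rowSum (placeRep K lam V) (PiTensorProduct.tprod K v)) = 0
  have hS : ∀ S : Finset lam.cells, ∑ f : lam.cells → lam.cells,
      (if (∀ x, r (f x) = r x) ∧ Finset.univ.image f ⊆ S then
        F (PiTensorProduct.tprod K fun x => v (f x)) else 0) = 0 := fun S => by
    have := hF fun i => ∑ c ∈ S with r c = i, v c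
    rw [MultilinearMap.map_sum_finset (PiTensorProduct.tprod K) (fun _ c => v c), map_sum] at this
    rw [← Finset.sum_filter, ← this]
    refine Finset.sum_congr ?_ fun _ _ => rfl
    ext f
    simp [Fintype.mem_piFinset, Finset.image_subset_iff, forall_and, and_comm]
  have h1 : ∑ S : Finset lam.cells, (-1 : K) ^ S.card • ∑ f : lam.cells → lam.cells,
      (if (∀ x, r (f x) = r x) ∧ Finset.univ.image f ⊆ S then
        F (PiTensorProduct.tprod K fun x => v (f x)) else 0) = 0 :=
    Finset.sum_eq_zero fun S _ => by rw [hS, smul_zero]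
  simp only [Finset.smul_sum] at h1
  rw [Finset.sum_comm] at h1
  have h2 : ∑ f : lam.cells → lam.cells, (if (∀ x, r (f x) = r x) ∧ Finset.univ.image f = Finset.univ
      then (-1 : K) ^ Fintype.card lam.cells • F (PiTensorProduct.tprod K fun x => v (f x))
      else 0) = 0 := by
    refine (Finset.sum_congr rfl fun f _ => ?_).trans h1
    by_cases hf : ∀ x, r (f x) = r x
    · have := congrArg (· • F (PiTensorProduct.tprod K fun x => v (f x)))
        (sum_neg_one_pow_card_superset (K := K) (Finset.univ.image f))
      simp only [Finset.sum_smul, ite_smul, zero_smul] at this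
      simp only [hf, implies_true, true_and, smul_ite, smul_zero]
      exact this.symm
    · simp only [hf, false_and, if_false, smul_zero, Finset.sum_const_zero]
  have h3 : (-1 : K) ^ Fintype.card lam.cells •
      F (rowSum (placeRep K lam V) (PiTensorProduct.tprod K v)) = 0 := by
    rw [← h2, rowSum, LinearMap.sum_apply, map_sum, Finset.smul_sum]
    -- The inverse appears because moving factors by `p` precomposes the family `v` with `p⁻¹`.
    refine Finset.sum_of_injOn (fun p => ⇑p⁻¹) ?_ (fun _ _ => Finset.mem_coe.2 (Finset.mem_univ _))
      ?_ ?_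
    · exact fun p _ q _ hpq => inv_injective (DFunLike.coe_injective hpq)
    · intro f _ hf
      refine if_neg fun ⟨hrow, hsurj⟩ => hf ?_
      have hbij : Function.Bijective f := Finite.surjective_iff_bijective.1 fun y => by
        simpa using (Finset.ext_iff.1 hsurj y).2 (Finset.mem_univ y)
      refine ⟨(Equiv.ofBijective f hbij)⁻¹, Finset.mem_coe.2 (inv_mem_rowPerms ?_), ?_⟩
      · exact mem_rowPerms.2 fun c => (hr _ _).1 (hrow c)
      · change ⇑((Equiv.ofBijective f hbij)⁻¹)⁻¹ = f
        rw [inv_inv]; rfl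
    · intro p hp
      rw [if_pos]
      · congr 2
        exact PiTensorProduct.reindex_tprod _ _
      · refine ⟨fun x => (hr _ _).2 (mem_rowPerms.1 (inv_mem_rowPerms hp) x), ?_⟩
        exact Finset.image_univ_of_surjective p⁻¹.surjective
  exact (smul_eq_zero.1 h3).resolve_left (pow_ne_zero _ (neg_ne_zero.2 one_ne_zero))

end Polarization

end TensorPower

/-! ### Homomorphisms between Schur functors -/

section SchurHom

variable {K : Type*} [Field K] {V : Type*} [AddCommGroup V] [Module K V]
  {lam mu : YoungDiagram}

/-- Reindexing a tensor power, as a linear map. -/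
abbrev reindexHom {α β : Type*} (h : α ≃ β) : (⨂[K] _ : α, V) →ₗ[K] ⨂[K] _ : β, V :=
  (PiTensorProduct.reindex K (fun _ => V) h).toLinearMap

theorem reindexHom_reindexHom {α β γ : Type*} (g : β ≃ γ) (h : α ≃ β) (v : ⨂[K] _ : α, V) :
    reindexHom g (reindexHom h v) = reindexHom (h.trans g) v :=
  PiTensorProduct.reindex_reindex (s := fun _ => V) h g v

section

variable [CharZero K]

theorem colSum_reindex_rowSum {h : lam.cells ≃ mu.cells} (hh : HasCollision h)
    (v : ⨂[K] _ : lam.cells, V) :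
    colSum K (placeRep K mu V) (reindexHom h (rowSum (placeRep K lam V) v)) = 0 := by
  classical
  obtain ⟨x, y, hxy, hrow, hcol⟩ := hh
  have hs : (Equiv.swap x y).trans h = h.trans (Equiv.swap (h x) (h y)) :=
    Equiv.ext fun z => h.injective.map_swap _ _ _
  have h1 : rowSum (placeRep K lam V) v = reindexHom (Equiv.swap x y) _ :=
    (LinearMap.congr_fun (map_mul_rowSum (rho := placeRep K lam V) (swap_mem_rowPerms hrow)) v).symm
  have h2 : ∀ u, colSum K (placeRep K mu V) (reindexHom (Equiv.swap (h x) (h y)) u) =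
      -colSum K (placeRep K mu V) u := fun u =>
    (LinearMap.congr_fun (colSum_mul_map (rho := placeRep K mu V) (swap_mem_colPerms hcol)) u).trans (by
      simp [Equiv.Perm.sign_swap (h.injective.ne hxy)])
  refine eq_zero_of_eq_neg (K := K) ?_
  conv_lhs => rw [h1, reindexHom_reindexHom, hs, ← reindexHom_reindexHom, h2]

theorem rowSum_reindex_colSum {h : lam.cells ≃ mu.cells} (hh : HasCollision h.symm)
    (v : ⨂[K] _ : lam.cells, V) :
    rowSum (placeRep K mu V) (reindexHom h (colSum K (placeRep K lam V) v)) = 0 := by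
  classical
  obtain ⟨x, y, hxy, hrow, hcol⟩ := hh
  have hs : h.trans (Equiv.swap x y) = (Equiv.swap (h.symm x) (h.symm y)).trans h :=
    Equiv.ext fun z => h.symm.injective (by simp [h.symm.injective.map_swap])
  have h1 : ∀ u, rowSum (placeRep K mu V) (reindexHom (Equiv.swap x y) u) =
      rowSum (placeRep K mu V) u :=
    LinearMap.congr_fun (rowSum_mul_map (rho := placeRep K mu V) (swap_mem_rowPerms hrow))
  have h2 : reindexHom (Equiv.swap (h.symm x) (h.symm y)) (colSum K (placeRep K lam V) v) =
      -colSum K (placeRep K lam V) v :=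
    (LinearMap.congr_fun (map_mul_colSum (rho := placeRep K lam V) (swap_mem_colPerms hcol)) v).trans (by
      simp [Equiv.Perm.sign_swap (h.symm.injective.ne hxy)])
  refine eq_zero_of_eq_neg (K := K) ?_
  conv_lhs => rw [← h1, reindexHom_reindexHom, hs, ← reindexHom_reindexHom, h2, map_neg, map_neg]

/-- The direction in which all bijections collide decides which row sum to expand: that of `mu`,
leaving column sum, bijection, row sum; or that of `lam`, leaving row sum, bijection, column sum. -/
theorem youngSymmetrizers_sandwich_eq_zero (hne : lam ≠ mu) (h : lam.cells ≃ mu.cells)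
    (v : ⨂[K] _ : lam.cells, V) :
    colSum K (placeRep K mu V) (rowSum (placeRep K mu V) (reindexHom h
      (rowSum (placeRep K lam V) (colSum K (placeRep K lam V) v)))) = 0 := by
  rcases forall_hasCollision_or hne with hc | hc
  · conv_lhs => rw [rowSum, LinearMap.sum_apply, map_sum]
    refine Finset.sum_eq_zero fun p _ => ?_
    change colSum K (placeRep K mu V) (reindexHom p _) = 0
    rw [reindexHom_reindexHom, colSum_reindex_rowSum (hc _)]
  · rw [rowSum.eq_1 (placeRep K lam V), LinearMap.sum_apply, map_sum, map_sum, map_sum]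
    refine Finset.sum_eq_zero fun p _ => ?_
    change colSum K (placeRep K mu V) (rowSum (placeRep K mu V) (reindexHom h (reindexHom p _))) = 0
    rw [reindexHom_reindexHom, rowSum_reindex_colSum (hc _), map_zero]

end

section

variable {ι : Type*} (b : Module.Basis ι K V) (r : lam.cells → ι)
  (hr : ∀ x y, r x = r y ↔ x.1.1 = y.1.1)

include hr in
theorem rowSum_tprod : rowSum (placeRep K lam V) (PiTensorProduct.tprod K fun x => b (r x)) =
    ((rowPerms lam).card : K) • PiTensorProduct.tprod K fun x => b (r x) := by
  rw [rowSum, LinearMap.sum_apply, Nat.cast_smul_eq_nsmul, ← Finset.sum_const]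
  refine Finset.sum_congr rfl fun p hp => (PiTensorProduct.reindex_tprod _ _).trans ?_
  congr 1
  funext x
  exact congrArg b ((hr _ _).2 (mem_rowPerms.1 (inv_mem_rowPerms hp) x))

-- The coordinate at `r` itself is 1: a column permutation fixing the tensor also preserves rows, so
-- it is the identity.
include hr in
theorem colSum_tprod_ne_zero :
    colSum K (placeRep K lam V) (PiTensorProduct.tprod K fun x => b (r x)) ≠ 0 := by
  classical
  let bas := Basis.piTensorProduct fun _ : lam.cells => b
  intro h0
  have h1 := congrArg (fun t => bas.repr t r) h0
  simp only [colSum, LinearMap.sum_apply, map_sum, LinearMap.smul_apply, map_smul, map_zero,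
    Finsupp.coe_zero, Pi.zero_apply, Finsupp.finsetSum_apply, Finsupp.smul_apply] at h1
  have h2 : ∀ q : Equiv.Perm lam.cells, placeRep K lam V q
      (PiTensorProduct.tprod K fun x => b (r x)) = bas (r ∘ ⇑q⁻¹) := fun q => by
    rw [Basis.piTensorProduct_apply]
    exact PiTensorProduct.reindex_tprod _ _
  rw [Finset.sum_eq_single 1] at h1
  · rw [h2, Module.Basis.repr_self, inv_one, Equiv.Perm.coe_one, Function.comp_id] at h1
    simp at h1
  · intro q hq hq1
    rw [h2, Module.Basis.repr_self, Finsupp.single_eq_of_ne, smul_zero]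
    intro h
    refine hq1 (inv_eq_one.1 (eq_one_of_mem_rowPerms_of_mem_colPerms (mem_rowPerms.2 fun c => ?_)
      (inv_mem_colPerms hq)))
    exact ((hr _ _).1 (congrFun h c)).symm
  · exact fun h => (h (mem_colPerms.2 fun _ => rfl)).elim

include b hr in
theorem schur_nontrivial [CharZero K] : ∃ s : Schur K lam V, s ≠ 0 := by
  refine ⟨schurProj K lam V (PiTensorProduct.tprod K fun x => b (r x)), fun h => ?_⟩
  have := schurEmb_schurProj (K := K) (PiTensorProduct.tprod K fun x => b (r x))
  rw [h, map_zero, Module.End.mul_apply, rowSum_tprod b r hr, map_smul] at this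
  exact (smul_ne_zero card_rowPerms_ne_zero (colSum_tprod_ne_zero b r hr)) this.symm

-- The weight argument gives the coefficients on the tensor labelled by rows. Equivariance of the
-- difference carries its vanishing over the orbit, and density and polarization carry it to all
-- row-symmetric tensors.
include b hr in
theorem exists_comp_rowSum_eq [CharZero K]
    (F : (⨂[K] _ : lam.cells, V) →ₗ[K] ⨂[K] _ : mu.cells, V) (hF : IsTensorEquivariant F) :
    ∃ c : (lam.cells ≃ mu.cells) → K, ∀ v, F (rowSum (placeRep K lam V) v) =
      ∑ h, c h • reindexHom h (rowSum (placeRep K lam V) v) := by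
  classical
  obtain ⟨c, hc⟩ := exists_sum_reindex b F hF r
  refine ⟨c, fun v => ?_⟩
  have key := comp_rowSum_eq_zero r hr (F - ∑ h, c h • reindexHom h) fun w =>
    tprod_eq_zero_of_forall_map b r _ (fun g => ?_) w
  · have := LinearMap.congr_fun key v
    simp only [LinearMap.comp_apply, LinearMap.sub_apply, LinearMap.sum_apply, LinearMap.smul_apply,
      LinearMap.zero_apply, sub_eq_zero] at this
    exact this
  · rw [LinearMap.sub_apply, hF, hc, LinearMap.sum_apply, map_sum, sub_eq_zero]
    refine Finset.sum_congr rfl fun h _ => ?_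
    rw [map_smul, LinearMap.smul_apply, map_reindex_apply]
    rfl

variable (f : Schur K lam V →ₗ[K] Schur K mu V)
  (hf : ∀ (g : LinearMap.GeneralLinearGroup K V) s,
    f (schurMap K lam (g : V →ₗ[K] V) s) = schurMap K mu (g : V →ₗ[K] V) (f s))

include b hr hf in
/-- Up to a nonzero scalar, an equivariant map of Schur functors is a combination of place
permutations between the two Young symmetrizers. -/
theorem exists_schurHom_eq [CharZero K] : ∃ (k : K) (c : (lam.cells ≃ mu.cells) → K), k ≠ 0 ∧
    ∀ v, k • schurEmb K mu V (f (schurProj K lam V v)) =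
      ∑ h, c h • colSum K (placeRep K mu V) (rowSum (placeRep K mu V) (reindexHom h
        (rowSum (placeRep K lam V) (colSum K (placeRep K lam V)
          (rowSum (placeRep K lam V) v))))) := by
  obtain ⟨k, hk, hk'⟩ := exists_schurProj_schurEmb K lam V
  obtain ⟨l, hl, hl'⟩ := exists_schurProj_schurEmb K mu V
  obtain ⟨c, hc⟩ := exists_comp_rowSum_eq b r hr
    (schurEmb K mu V ∘ₗ f ∘ₗ schurProj K lam V) fun g v => by
      simp only [LinearMap.comp_apply]
      rw [← schurMap_schurProj, hf, schurEmb_schurMap]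
  -- The factors `k` and `l` pay for an extra symmetrizer on the source and on the target, and the
  -- order of the row group for one more row sum on the source.
  refine ⟨l * (((rowPerms lam).card : K) * k), c,
    mul_ne_zero hl (mul_ne_zero card_rowPerms_ne_zero hk), fun v => ?_⟩
  have h1 : (((rowPerms lam).card : K) * k) • schurProj K lam V v = schurProj K lam V
      (rowSum (placeRep K lam V) (colSum K (placeRep K lam V) (rowSum (placeRep K lam V) v))) := by
    rw [schurProj_rowSum, mul_smul, ← hk', schurEmb_schurProj, Module.End.mul_apply]
  have h2 : ∀ s, l • schurEmb K mu V s = colSum K (placeRep K mu V) (rowSum (placeRep K mu V)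
      (schurEmb K mu V s)) := fun s => by
    rw [← map_smul, ← hl', schurEmb_schurProj, Module.End.mul_apply]
  rw [mul_smul, ← (schurEmb K mu V).map_smul (_ * _), ← f.map_smul, h1, h2]
  have := hc (colSum K (placeRep K lam V) (rowSum (placeRep K lam V) v))
  simp only [LinearMap.comp_apply] at this
  rw [this, map_sum, map_sum]
  exact Finset.sum_congr rfl fun h _ => by rw [map_smul, map_smul]

theorem schurEmb_injective [CharZero K] : Function.Injective (schurEmb K lam V) := fun s t h => by
  obtain ⟨k, hk, hk'⟩ := exists_schurProj_schurEmb K lam V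
  have := congrArg (schurProj K lam V) h
  rw [hk', hk'] at this
  exact smul_right_injective _ hk this

include b hr hf in
theorem schurHom_eq_zero [CharZero K] (hne : lam ≠ mu) (s : Schur K lam V) : f s = 0 := by
  obtain ⟨k, c, hk, h⟩ := exists_schurHom_eq b r hr f hf
  obtain ⟨v, rfl⟩ := schurProj_surjective s
  refine schurEmb_injective (smul_right_injective _ hk ?_)
  simp only [h, map_zero, smul_zero]
  refine Finset.sum_eq_zero fun e _ => ?_
  rw [youngSymmetrizers_sandwich_eq_zero hne, smul_zero]

end

/-- For `lam = mu` everything between the outer column sum and the outer row sum is a group algebra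
element, so the product collapses to a multiple of their product, which is `schurEmb ∘ schurProj`.
-/
theorem exists_schurHom_eq_smul [CharZero K] {ι : Type*} (b : Module.Basis ι K V)
    (r : lam.cells → ι) (hr : ∀ x y, r x = r y ↔ x.1.1 = y.1.1)
    (f : Schur K lam V →ₗ[K] Schur K lam V)
    (hf : ∀ (g : LinearMap.GeneralLinearGroup K V) s,
      f (schurMap K lam (g : V →ₗ[K] V) s) = schurMap K lam (g : V →ₗ[K] V) (f s)) :
    ∃ a : K, ∀ s, f s = a • s := by
  obtain ⟨k, c, hk, h⟩ := exists_schurHom_eq b r hr f hf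
  let of := MonoidAlgebra.of K (Equiv.Perm lam.cells)
  obtain ⟨a, ha⟩ := colSum_mul_lift_mul_rowSum (K := K) (placeRep K lam V)
    (rowSum of * (∑ e : Equiv.Perm lam.cells, c e • of e) * rowSum of * colSum K of)
  rw [map_mul, map_mul, map_mul, lift_rowSum, lift_colSum] at ha
  refine ⟨k⁻¹ * a, fun s => ?_⟩
  obtain ⟨v, rfl⟩ := schurProj_surjective s
  refine schurEmb_injective (smul_right_injective _ hk ?_)
  have := LinearMap.congr_fun ha v
  simp only [h, map_smul, smul_smul, mul_inv_cancel_left₀ hk]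
  rw [schurEmb_schurProj, ← LinearMap.smul_apply, ← ha]
  simp only [Module.End.mul_apply, map_sum, map_smul, LinearMap.sum_apply, LinearMap.smul_apply, of,
    MonoidAlgebra.lift_of]
  rfl

end SchurHom

/-! ### The grading of the free Lie algebra -/

section Grading

variable (K : Type*) [Field K] (V : Type*) [AddCommGroup V] [Module K V]

/-- The zero bracket on an abelian group. -/
abbrev abelianLieRing : LieRing V where
  bracket _ _ := 0
  add_lie _ _ _ := (add_zero _).symm
  lie_add _ _ _ := (add_zero _).symm
  lie_self _ := rfl
  leibniz_lie _ _ _ := (add_zero _).symm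

/-- The zero bracket is bilinear. -/
abbrev abelianLieAlgebra : @LieAlgebra K V _ (abelianLieRing V) :=
  letI := abelianLieRing V
  { ‹Module K V› with lie_smul := fun a _ _ => (smul_zero a).symm }

variable {K V}

namespace FreeLie

theorem map_incl (f : V →ₗ[K] V) (v : V) : map f (incl K v) = incl K (f v) :=
  lift_incl _ v

variable (K V) in
/-- The projection of the free Lie algebra onto its degree one part. -/
def proj : FreeLie K V →ₗ[K] V :=
  letI := abelianLieRing V
  letI := abelianLieAlgebra K V
  (lift (LinearMap.id : V →ₗ[K] V) : FreeLie K V →ₗ⁅K⁆ V).toLinearMap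

theorem proj_incl (v : V) : proj K V (incl K v) = v :=
  letI := abelianLieRing V
  letI := abelianLieAlgebra K V
  lift_incl (LinearMap.id : V →ₗ[K] V) v

theorem proj_map (f : V →ₗ[K] V) (x : FreeLie K V) : proj K V (map f x) = f (proj K V x) := by
  let := abelianLieRing V
  let := abelianLieAlgebra K V
  let f' : V →ₗ⁅K⁆ V := { f with map_lie' := fun {x y} => f.map_zero }
  have : (lift (LinearMap.id : V →ₗ[K] V)).comp (map f) =
      f'.comp (lift (LinearMap.id : V →ₗ[K] V)) := hom_ext fun v => by
    rw [LieHom.comp_apply, LieHom.comp_apply, map_incl, lift_incl, lift_incl]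
    rfl
  exact LieHom.congr_fun this x

theorem mem_of_incl_mem (S : LieSubalgebra K (FreeLie K V)) (h : ∀ v, incl K v ∈ S)
    (x : FreeLie K V) : x ∈ S := by
  let f : V →ₗ[K] S := (incl K).codRestrict S.toSubmodule h
  have : S.incl.comp (lift f) = LieHom.id := hom_ext fun v => by
    rw [LieHom.comp_apply, lift_incl]
    rfl
  have hx := LieHom.congr_fun this x
  rw [LieHom.comp_apply, LieHom.id_apply] at hx
  rw [← hx]
  exact (lift f x).2

variable (K V) in
/-- The endomorphism of the free Lie algebra that multiplies the generators by two. -/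
def double : FreeLie K V →ₗ⁅K⁆ FreeLie K V := map ((2 : K) • LinearMap.id)

theorem double_incl (v : V) : double K V (incl K v) = (2 : K) • incl K v := by
  rw [double, map_incl, LinearMap.smul_apply, map_smul, LinearMap.id_apply]

variable (K V) in
/-- The elements of degree one, and the homogeneous elements of degree at least two. -/
def homogeneous : Set (FreeLie K V) :=
  Set.range (incl K) ∪ {x | ∃ k, 2 ≤ k ∧ double K V x = (2 ^ k : K) • x}

theorem lie_mem_homogeneous {x y : FreeLie K V} (hx : x ∈ homogeneous K V)
    (hy : y ∈ homogeneous K V) : ⁅x, y⁆ ∈ homogeneous K V := by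
  have key : ∀ z ∈ homogeneous K V, ∃ k, 1 ≤ k ∧ double K V z = (2 ^ k : K) • z := by
    rintro _ (⟨v, rfl⟩ | ⟨k, hk, hz⟩)
    · exact ⟨1, le_rfl, by rw [double_incl, pow_one]⟩
    · exact ⟨k, by omega, hz⟩
  obtain ⟨k, hk, hx⟩ := key x hx
  obtain ⟨l, hl, hy⟩ := key y hy
  refine Or.inr ⟨k + l, by omega, ?_⟩
  rw [LieHom.map_lie, hx, hy, smul_lie, lie_smul, smul_smul, pow_add]

/-- The span contains the generators and is closed under brackets, since `double` respects brackets
and its eigenvalues multiply. -/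
theorem span_homogeneous : ⊤ ≤ Submodule.span K (homogeneous K V) := by
  let S : LieSubalgebra K (FreeLie K V) :=
    { Submodule.span K (homogeneous K V) with
      lie_mem' := fun {x y} hx hy => by
        induction hx, hy using Submodule.span_induction₂ with
        | mem_mem x y hx hy => exact Submodule.subset_span (lie_mem_homogeneous hx hy)
        | zero_left y _ => rw [zero_lie]; exact Submodule.zero_mem _
        | zero_right x _ => rw [lie_zero]; exact Submodule.zero_mem _
        | add_left x y z _ _ _ h1 h2 => rw [add_lie]; exact Submodule.add_mem _ h1 h2
        | add_right x y z _ _ _ h1 h2 => rw [lie_add]; exact Submodule.add_mem _ h1 h2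
        | smul_left r x y _ _ h => rw [smul_lie]; exact Submodule.smul_mem _ r h
        | smul_right r x y _ _ h => rw [lie_smul]; exact Submodule.smul_mem _ r h }
  exact fun x _ => mem_of_incl_mem S (fun v => Submodule.subset_span (Or.inl ⟨v, rfl⟩)) x

/-- The projection carries `double` to multiplication by 2, and `2 ^ k ≠ 2` in characteristic 0. -/
theorem proj_eq_zero [CharZero K] {x : FreeLie K V} {k : ℕ} (hk : 2 ≤ k)
    (hx : double K V x = (2 ^ k : K) • x) : proj K V x = 0 := by
  have h1 : proj K V (double K V x) = (2 : K) • proj K V x := proj_map _ x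
  rw [hx, map_smul, ← sub_eq_zero, ← sub_smul, smul_eq_zero] at h1
  refine h1.resolve_left fun h => ?_
  have h2 : (2 ^ k : ℕ) = 2 ^ 1 := by exact_mod_cast (sub_eq_zero.1 h).trans (pow_one 2).symm
  have := Nat.pow_right_injective le_rfl h2
  omega

variable (K V) in
/-- The projection onto degree one, as an endomorphism. -/
def degOne : FreeLie K V →ₗ[K] FreeLie K V := incl K ∘ₗ proj K V

theorem eq_or_of_mem_homogeneous [CharZero K] {x : FreeLie K V} (hx : x ∈ homogeneous K V) :
    ∃ k, double K V x = (2 ^ k : K) • x ∧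
      (k = 1 ∧ degOne K V x = x ∨ 2 ≤ k ∧ degOne K V x = 0) := by
  rcases hx with ⟨v, rfl⟩ | ⟨k, hk, hx⟩
  · exact ⟨1, by rw [double_incl, pow_one], Or.inl ⟨rfl, congrArg (incl K) (proj_incl v)⟩⟩
  · exact ⟨k, hx, Or.inr ⟨hk, (congrArg (incl K) (proj_eq_zero hk hx)).trans (map_zero _)⟩⟩

end FreeLie

open FreeLie

variable {mu : YoungDiagram}

theorem schurMap_smul_id [CharZero K] (a : K) (s : Schur K mu V) :
    schurMap K mu (a • LinearMap.id : V →ₗ[K] V) s = a ^ mu.card • s := by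
  obtain ⟨v, rfl⟩ := schurProj_surjective s
  rw [schurMap_schurProj, ← map_smul]
  congr 1
  suffices PiTensorProduct.map (fun _ : mu.cells => (a • LinearMap.id : V →ₗ[K] V)) =
      a ^ mu.card • LinearMap.id from LinearMap.congr_fun this v
  refine PiTensorProduct.ext (MultilinearMap.ext fun w => ?_)
  change PiTensorProduct.map _ (PiTensorProduct.tprod K w) = a ^ mu.card • PiTensorProduct.tprod K w
  rw [PiTensorProduct.map_tprod]
  refine (MultilinearMap.map_smul_univ _ (fun _ => a) w).trans ?_
  rw [Finset.prod_const, Finset.card_univ, Fintype.card_coe]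

/-- The part of `S_mu(L(V))` on which doubling acts by `2 ^ |mu|` is `S_mu(V)`. -/
theorem schurMap_degOne_eq [CharZero K] (s : Schur K mu (FreeLie K V))
    (hs : schurMap K mu (double K V : FreeLie K V →ₗ[K] FreeLie K V) s = (2 ^ mu.card : K) • s) :
    schurMap K mu (degOne K V) s = s := by
  classical
  set D : Module.End K (Schur K mu (FreeLie K V)) :=
    schurMap K mu (double K V : FreeLie K V →ₗ[K] FreeLie K V)
  let N := ⨆ (a : K) (_ : a ≠ 2 ^ mu.card), D.eigenspace a
  have hdisj : Disjoint (D.eigenspace (2 ^ mu.card)) N := D.eigenspaces_iSupIndep _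
  let b := Module.Basis.ofSpan (span_homogeneous (K := K) (V := V))
  have hb : ∀ j, b j ∈ homogeneous K V := fun j =>
    Module.Basis.ofSpan_subset span_homogeneous ⟨j, rfl⟩
  choose k hk hk' using fun j => eq_or_of_mem_homogeneous (hb j)
  -- For every `s`, the difference between `s` and its degree-one part lies in the sum `N` of the
  -- other eigenspaces. This is checked on tensors of homogeneous basis elements.
  have key : N.mkQ ∘ₗ (LinearMap.id - schurMap K mu (degOne K V)) ∘ₗ
      schurProj K mu (FreeLie K V) = 0 := by
    refine (Basis.piTensorProduct fun _ : mu.cells => b).ext fun p => ?_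
    rw [Basis.piTensorProduct_apply, LinearMap.zero_apply, LinearMap.comp_apply,
      Submodule.mkQ_apply, Submodule.Quotient.mk_eq_zero, LinearMap.comp_apply,
      LinearMap.sub_apply, LinearMap.id_apply, schurMap_schurProj, PiTensorProduct.map_tprod]
    by_cases hp : ∀ x, k (p x) = 1
    · have : ∀ x, degOne K V (b (p x)) = b (p x) := fun x =>
        ((hk' (p x)).resolve_right fun h => by have := hp x; omega).2
      simp only [this, sub_self, Submodule.zero_mem]
    · push Not at hp
      obtain ⟨x, hx⟩ := hp
      have hx' := (hk' (p x)).resolve_left fun h => hx h.1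
      rw [MultilinearMap.map_coord_zero (m := fun y => degOne K V (b (p y))) _ x hx'.2, map_zero, sub_zero]
      have hD : D (schurProj K mu _ (PiTensorProduct.tprod K fun y => b (p y))) =
          (2 ^ (∑ y, k (p y)) : K) •
            schurProj K mu _ (PiTensorProduct.tprod K fun y => b (p y)) := by
        rw [schurMap_schurProj, PiTensorProduct.map_tprod, ← map_smul, ← Finset.prod_pow_eq_pow_sum]
        simp only [LieHom.coe_toLinearMap, hk]
        rw [← MultilinearMap.map_smul_univ]
      have hlt : mu.card < ∑ y, k (p y) := by
        have h1 : mu.card = ∑ _y : mu.cells, 1 := by simp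
        rw [h1]
        refine Finset.sum_lt_sum (fun y _ => ?_) ⟨x, Finset.mem_univ x, hx'.1⟩
        rcases hk' (p y) with h | h <;> omega
      refine Submodule.mem_iSup_of_mem (2 ^ (∑ y, k (p y))) (Submodule.mem_iSup_of_mem ?_
        (Module.End.mem_eigenspace_iff.2 hD))
      intro h
      have h2 : (2 ^ (∑ y, k (p y)) : ℕ) = 2 ^ mu.card := by exact_mod_cast h
      exact hlt.ne' (Nat.pow_right_injective le_rfl h2)
  obtain ⟨t, rfl⟩ := schurProj_surjective s
  have h1 := LinearMap.congr_fun key t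
  rw [LinearMap.zero_apply, LinearMap.comp_apply, Submodule.mkQ_apply,
    Submodule.Quotient.mk_eq_zero, LinearMap.comp_apply, LinearMap.sub_apply,
    LinearMap.id_apply] at h1
  have hcomm : (double K V : FreeLie K V →ₗ[K] FreeLie K V) ∘ₗ degOne K V =
      degOne K V ∘ₗ (double K V : FreeLie K V →ₗ[K] FreeLie K V) := LinearMap.ext fun x => by
    change double K V (incl K (proj K V x)) = incl K (proj K V (double K V x))
    rw [double, proj_map, map_incl]
  -- For the given eigenvector this difference is also in the `2 ^ |mu|`-eigenspace, because
  -- `degOne` commutes with `double`; independence of eigenspaces makes it zero.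
  refine (sub_eq_zero.1 (Submodule.disjoint_def.1 hdisj _ (Module.End.mem_eigenspace_iff.2 ?_)
    h1)).symm
  have hcomm' := LinearMap.congr_fun (congrArg (schurMap K mu) hcomm)
    (schurProj K mu (FreeLie K V) t)
  rw [schurMap_comp, schurMap_comp, LinearMap.comp_apply, LinearMap.comp_apply] at hcomm'
  rw [map_sub, smul_sub, ← (schurMap K mu (degOne K V)).map_smul, ← hs]
  exact congrArg (D _ - ·) hcomm'

end Grading

/-! ### Multiplicities of Schur functors in Schur functors of the free Lie algebra -/

section Multiplicity

variable {K : Type*} [Field K] {V : Type*} [AddCommGroup V] [Module K V]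

/-- When the dimension of `V` is at least the number of rows, distinct rows can be labelled by
distinct vectors of a basis. -/
theorem exists_rowLabel (lam : YoungDiagram) (hV : (lam.colLen 0 : Cardinal) ≤ Module.rank K V) :
    ∃ r : lam.cells → Module.Basis.ofVectorSpaceIndex K V,
      ∀ x y, r x = r y ↔ x.1.1 = y.1.1 := by
  rw [← (Module.Basis.ofVectorSpace K V).mk_eq_rank''] at hV
  obtain ⟨e⟩ : Nonempty (Fin (lam.colLen 0) ↪ Module.Basis.ofVectorSpaceIndex K V) := by
    rw [← Cardinal.lift_mk_le', Cardinal.mk_fin]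
    simpa using hV
  have hx : ∀ x : lam.cells, x.1.1 < lam.colLen 0 := fun x =>
    YoungDiagram.mem_iff_lt_colLen.1
      (lam.up_left_mem le_rfl (Nat.zero_le _) ((YoungDiagram.mem_cells x.1).1 x.2))
  exact ⟨fun x => e ⟨x.1.1, hx x⟩, fun x y => by rw [e.apply_eq_iff_eq, Fin.mk.injEq]⟩

variable {lam mu : YoungDiagram}

open FreeLie in
theorem schurMap_proj_schurRep (g : LinearMap.GeneralLinearGroup K V)
    (s : Schur K mu (FreeLie K V)) :
    schurMap K mu (proj K V) (schurRep K mu (freeLieRep (stdRep K V)) g s) =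
      schurMap K mu (g : V →ₗ[K] V) (schurMap K mu (proj K V) s) := by
  have : proj K V ∘ₗ (freeLieRep (stdRep K V) g) = (g : V →ₗ[K] V) ∘ₗ proj K V :=
    LinearMap.ext fun x => proj_map _ x
  change schurMap K mu (proj K V) (schurMap K mu (freeLieRep (stdRep K V) g) s) = _
  rw [← LinearMap.comp_apply, ← schurMap_comp, this, schurMap_comp, LinearMap.comp_apply]

open FreeLie in
theorem schurMap_incl_schurMap (g : LinearMap.GeneralLinearGroup K V) (s : Schur K mu V) :
    schurMap K mu (incl K) (schurMap K mu (g : V →ₗ[K] V) s) =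
      schurRep K mu (freeLieRep (stdRep K V)) g (schurMap K mu (incl K) s) := by
  have : (freeLieRep (stdRep K V) g) ∘ₗ incl K = incl K ∘ₗ (g : V →ₗ[K] V) :=
    LinearMap.ext fun x => map_incl _ x
  change _ = schurMap K mu (freeLieRep (stdRep K V) g) (schurMap K mu (incl K) s)
  rw [← LinearMap.comp_apply, ← LinearMap.comp_apply, ← schurMap_comp, ← schurMap_comp, this]

open FreeLie in
theorem schurMap_proj_incl (s : Schur K mu V) :
    schurMap K mu (proj K V) (schurMap K mu (incl K) s) = s := by
  have : proj K V ∘ₗ incl K = LinearMap.id := LinearMap.ext fun v => proj_incl v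
  rw [← LinearMap.comp_apply, ← schurMap_comp, this, schurMap_id, LinearMap.id_apply]

open FreeLie in
/-- An equivariant map from a Schur functor of the same degree takes values in `S_mu(V)`. -/
theorem schurMap_incl_proj_of_equivariant [CharZero K] (hcard : lam.card = mu.card)
    (f : Schur K lam V →ₗ[K] Schur K mu (FreeLie K V))
    (hf : ∀ g s, f (schurRep K lam (stdRep K V) g s) =
      schurRep K mu (freeLieRep (stdRep K V)) g (f s)) (s : Schur K lam V) :
    schurMap K mu (incl K) (schurMap K mu (proj K V) (f s)) = f s := by
  rw [← LinearMap.comp_apply, ← schurMap_comp]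
  refine schurMap_degOne_eq _ ?_
  let g : LinearMap.GeneralLinearGroup K V :=
    { val := (2 : K) • LinearMap.id
      inv := (2⁻¹ : K) • LinearMap.id
      val_inv := LinearMap.ext fun v => by simp [smul_smul]
      inv_val := LinearMap.ext fun v => by simp [smul_smul] }
  refine (hf g s).symm.trans ?_
  rw [← map_smul, ← hcard]
  exact congrArg f (schurMap_smul_id 2 s)

/-- The restriction of an intertwining map to one copy. -/
def restrictCopy {m : ℕ} (i : Representation.IntertwiningMap
    (Representation.directSum fun _ : Fin m => schurRep K lam (stdRep K V))
    (schurRep K mu (freeLieRep (stdRep K V)))) (j : Fin m) :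
    Schur K lam V →ₗ[K] Schur K mu (FreeLie K V) :=
  i.toLinearMap ∘ₗ DirectSum.lof K (Fin m) (fun _ => Schur K lam V) j

theorem restrictCopy_equivariant {m : ℕ} (i : Representation.IntertwiningMap
    (Representation.directSum fun _ : Fin m => schurRep K lam (stdRep K V))
    (schurRep K mu (freeLieRep (stdRep K V)))) (j : Fin m)
    (g : LinearMap.GeneralLinearGroup K V) (s : Schur K lam V) :
    restrictCopy i j (schurRep K lam (stdRep K V) g s) =
      schurRep K mu (freeLieRep (stdRep K V)) g (restrictCopy i j s) := by
  have := i.isIntertwining _ _ g (DirectSum.lof K (Fin m) (fun _ => Schur K lam V) j s)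
  rw [Representation.directSum_apply, DirectSum.lmap_lof] at this
  exact this

open FreeLie in
theorem proj_restrictCopy_equivariant {m : ℕ} (i : Representation.IntertwiningMap
    (Representation.directSum fun _ : Fin m => schurRep K lam (stdRep K V))
    (schurRep K mu (freeLieRep (stdRep K V)))) (j : Fin m)
    (g : LinearMap.GeneralLinearGroup K V) (s : Schur K lam V) :
    (schurMap K mu (proj K V) ∘ₗ restrictCopy i j) (schurMap K lam (g : V →ₗ[K] V) s) =
      schurMap K mu (g : V →ₗ[K] V) ((schurMap K mu (proj K V) ∘ₗ restrictCopy i j) s) := by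
  rw [LinearMap.comp_apply, LinearMap.comp_apply, ← schurMap_proj_schurRep,
    ← restrictCopy_equivariant]
  rfl

theorem lof_injective {m : ℕ} (j : Fin m) :
    Function.Injective (DirectSum.lof K (Fin m) (fun _ => Schur K lam V) j) :=
  Function.LeftInverse.injective (g := DirectSum.component K (Fin m) (fun _ => Schur K lam V) j)
    fun s => DirectSum.component.lof_self (M := fun _ : Fin m => Schur K lam V) K j s

theorem eq_zero_of_isSummand [CharZero K] (hV : (lam.colLen 0 : Cardinal) ≤ Module.rank K V)
    (hcard : lam.card = mu.card) (hne : lam ≠ mu) {m : ℕ}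
    (h : IsSummand (schurRep K lam (stdRep K V)) (schurRep K mu (freeLieRep (stdRep K V))) m) :
    m = 0 := by
  obtain ⟨i, p, hip⟩ := h
  obtain ⟨r, hr⟩ := exists_rowLabel lam hV
  obtain ⟨s, hs⟩ := schur_nontrivial (Module.Basis.ofVectorSpace K V) r hr
  by_contra hm
  let j : Fin m := ⟨0, Nat.pos_of_ne_zero hm⟩
  have h1 : schurMap K mu (FreeLie.proj K V) (restrictCopy i j s) = 0 :=
    schurHom_eq_zero (Module.Basis.ofVectorSpace K V) r hr _
      (proj_restrictCopy_equivariant i j) hne s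
  have h2 := schurMap_incl_proj_of_equivariant hcard _ (restrictCopy_equivariant i j) s
  rw [h1, map_zero] at h2
  have h3 := hip (DirectSum.lof K (Fin m) (fun _ => Schur K lam V) j s)
  change p (restrictCopy i j s) = _ at h3
  rw [← h2, map_zero] at h3
  exact hs (lof_injective j (h3.symm.trans (map_zero _).symm))

theorem le_one_of_isSummand [CharZero K] (hV : (lam.colLen 0 : Cardinal) ≤ Module.rank K V) {m : ℕ}
    (h : IsSummand (schurRep K lam (stdRep K V)) (schurRep K lam (freeLieRep (stdRep K V))) m) :
    m ≤ 1 := by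
  obtain ⟨i, p, hip⟩ := h
  obtain ⟨r, hr⟩ := exists_rowLabel lam hV
  obtain ⟨s, hs⟩ := schur_nontrivial (Module.Basis.ofVectorSpace K V) r hr
  by_contra! hm
  have h1 : ∀ j : Fin m, ∃ a : K, ∀ s, restrictCopy i j s =
      a • schurMap K lam (FreeLie.incl K) s := fun j => by
    obtain ⟨a, ha⟩ := exists_schurHom_eq_smul (Module.Basis.ofVectorSpace K V) r hr _
      (proj_restrictCopy_equivariant i j)
    refine ⟨a, fun s => ?_⟩
    rw [← schurMap_incl_proj_of_equivariant rfl _ (restrictCopy_equivariant i j) s, ← map_smul,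
      ← ha]
    rfl
  choose a ha using h1
  have h2 : ∀ j s, p (restrictCopy i j s) =
      DirectSum.lof K (Fin m) (fun _ => Schur K lam V) j s := fun j s => hip _
  have hne : ∀ j, a j ≠ 0 := fun j h0 => by
    have := h2 j s
    rw [ha, h0, zero_smul, map_zero] at this
    exact hs (lof_injective j (this.symm.trans (map_zero _).symm))
  let j₀ : Fin m := ⟨0, by omega⟩
  let j₁ : Fin m := ⟨1, hm⟩
  -- Both copies embed as multiples of the same map, so cross-multiplying the scalars gives elements
  -- of two different copies with the same image, against the existence of a retraction.
  have h3 : DirectSum.lof K (Fin m) (fun _ => Schur K lam V) j₀ (a j₁ • s) =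
      DirectSum.lof K (Fin m) (fun _ => Schur K lam V) j₁ (a j₀ • s) := by
    rw [← h2, ← h2, ha, ha, (schurMap K lam (FreeLie.incl K)).map_smul,
      (schurMap K lam (FreeLie.incl K)).map_smul, smul_smul, smul_smul, mul_comm]
  have h4 := congrArg (DirectSum.component K (Fin m) (fun _ => Schur K lam V) j₀) h3
  rw [DirectSum.component.lof_self, DirectSum.component.of,
    dif_neg (by simp [j₀, j₁])] at h4
  exact smul_ne_zero (hne j₁) hs h4

/-- `V` is an equivariant retract of `L(V)` through `incl` and `proj`, and functors preserve
retracts. -/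
theorem isSummand_one :
    IsSummand (schurRep K lam (stdRep K V)) (schurRep K lam (freeLieRep (stdRep K V))) 1 := by
  refine ⟨LinearMap.intertwiningMap_of_isIntertwiningMap _ _
      (schurMap K lam (FreeLie.incl K) ∘ₗ
        DirectSum.component K (Fin 1) (fun _ => Schur K lam V) 0) fun g x => ?_,
    LinearMap.intertwiningMap_of_isIntertwiningMap _ _
      (DirectSum.lof K (Fin 1) (fun _ => Schur K lam V) 0 ∘ₗ
        schurMap K lam (FreeLie.proj K V)) fun g x => ?_, fun x => ?_⟩
  · exact schurMap_incl_schurMap g _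
  · rw [LinearMap.comp_apply, LinearMap.comp_apply, schurMap_proj_schurRep,
      Representation.directSum_apply, DirectSum.lmap_lof]
    rfl
  · change DirectSum.lof K (Fin 1) (fun _ => Schur K lam V) 0 (schurMap K lam (FreeLie.proj K V)
      (schurMap K lam (FreeLie.incl K) (DirectSum.component K (Fin 1) (fun _ => Schur K lam V) 0 x)))
      = x
    rw [schurMap_proj_incl]
    refine DirectSum.ext_component K fun j => ?_
    rw [Subsingleton.elim j 0, DirectSum.component.lof_self]

end Multiplicity

end LieSchur

end

theorem mainTheorem2 {K : Type*} [Field K] [CharZero K] {V : Type*} [AddCommGroup V] [Module K V]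
    (lam mu : YoungDiagram) (hV : (lam.colLen 0 : Cardinal) ≤ Module.rank K V)
    (hcard : lam.card = mu.card) :
    (lam = mu → LieSchur.coeff K V lam mu = 1) ∧
      (lam ≠ mu → LieSchur.coeff K V lam mu = 0) := by
  constructor
  · rintro rfl
    refine le_antisymm (iSup₂_le fun m hm => ?_) ?_
    · exact_mod_cast LieSchur.le_one_of_isSummand hV hm
    · exact le_iSup₂_of_le 1 LieSchur.isSummand_one le_rfl
  · intro hne
    refine le_antisymm (iSup₂_le fun m hm => ?_) zero_le
    rw [LieSchur.eq_zero_of_isSummand hV hcard hne hm]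
    rfl
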